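/- **Conventions.** Manifolds are smooth, finite-dimensional, Hausdorff and without boundary; vector bundles are real, smooth and of finite rank; maps are smooth. A *Lie algebroid* over $M$ is a vector bundle $A\to M$ with a vector bundle map $\rho_A:A\to TM$ (the anchor) and a real Lie bracket $[\cdot,\cdot]_A$ on its space of smooth sections $\Gamma A$ such that $[a,fb]_A=f[a,b]_A+(\rho_A(a)\cdot f)\,b$ for $f\in C^\infty(M)$ and $\rho_A[a,b]_A=[\rho_A a,\rho_A b]$. An *isomorphism* of Lie algebroids over $M$ is an isomorphism of vector bundles over $\mathrm{id}_M$ that preserves the anchors and the brackets of sections. *Derivations.* For a vector bundle $E\to M$, the fibre of $\mathcal{D}E$ at $x\in M$ consists of the pairs $(\delta,v)$ of an $\mathbb{R}$-linear map $\delta:\Gamma E\to E_x$ and a vector $v\in T_xM$ with $\delta(fs)=f(x)\,\delta(s)+(v\cdot f)\,s(x)$ for all $f\in C^\infty(M)$, $s\in\Gamma E$. A section $x\mapsto(\delta_x,v_x)$ over an open set $U$ is smooth if $x\mapsto v_x$ is smooth and $x\mapsto\delta_x(s)$ is smooth on $U$ for every $s\in\Gamma E$. The anchor is $(\delta,v)\mapsto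 v$, and the bracket of sections is the commutator of operators on $\Gamma E$, together with the Lie bracket of the vector fields $v$. *Pull-back.* Let $B\to N$ be a Lie algebroid and $\varphi:M\to N$ a smooth map. The map $\varphi$ is *admissible* for $B$ if the spaces $\{(b,u)\in B_{\varphi(m)}\oplus T_mM : \rho_B(b)=(T_m\varphi)u\}$ have a dimension independent of $m$. In that case these spaces form the sub-bundle $B\oplus_{TN}TM$ of the direct sum of $TM$ and the pull-back vector bundle of $B$. The *pull-back Lie algebroid* $\varphi^!B$ is this sub-bundle, with the projection to $TM$ as anchor. Its bracket is given at a point $m$ by $$\Big[\big(\textstyle\sum_i f_i\otimes b_i,u\big),\big(\sum_j g_j\otimes c_j,v\big)\Big]=\Big(\sum_{i,j}f_ig_j\otimes[b_i,c_j]_B+\sum_j(u\cdot g_j)\otimes c_j-\sum_i(v\cdot f_i)\otimes b_i,\;[u,v]\Big)$$ whenever the two sections are $(\sum_i f_i\otimes b_i,u)$ and $(\sum_j g_j\otimes c_j,v)$ in a neighbourhood of $m$, where $f_i,g_j\in C^\infty(M)$, $b_i,c_j\in\Gamma B$, $u,v\in\Gamma(TM)$, the sums are finite and $f\otimes b$ denotes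 the section $x\mapsto f(x)\,b(\varphi(x))$. **Proposition 3.4.** Let $F\to N$ be a vector bundle and $\varphi:M\to N$ a smooth map. Then $\mathcal{D}F$ is a Lie algebroid, $\varphi$ is admissible for $\mathcal{D}F$, the bracket of $\varphi^!(\mathcal{D}F)$ is well defined by the formula above, and $\varphi^!(\mathcal{D}F)$ and $\mathcal{D}(\varphi^!F)$, where $\varphi^!F$ is the pull-back vector bundle, are Lie algebroids over $M$ which are isomorphic over $\mathrm{id}_M$. -/

import Mathlib

open scoped Manifold ContDiff Topology
open Bundle VectorField

noncomputable section

/-! ### Vector fields acting on functions -/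

section VectorFields

variable {E : Type*} [NormedAddCommGroup E] [NormedSpace ℝ E] {H : Type*} [TopologicalSpace H]
  {I : ModelWithCorners ℝ E H} {M : Type*} [TopologicalSpace M] [ChartedSpace H M]

/-- The vector field `X` is smooth on the set `U`. -/
def SmoothFieldOn [IsManifold I ∞ M] (X : ∀ x : M, TangentSpace I x) (U : Set M) : Prop :=
  ContMDiffOn I I.tangent ∞ (fun x => (⟨x, X x⟩ : TangentBundle I M)) U

/-- A smooth vector field applied to a smooth function is a smooth function. -/
theorem contMDiffAt_mvfderiv_apply [IsManifold I ∞ M] {X : ∀ x : M, TangentSpace I x} {f : M → ℝ}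
    {x : M} (hX : ContMDiffAt I I.tangent ∞ (fun x => (⟨x, X x⟩ : TangentBundle I M)) x)
    (hf : ContMDiff I 𝓘(ℝ, ℝ) ∞ f) :
    ContMDiffAt I 𝓘(ℝ, ℝ) ∞ (fun y => mvfderiv I f y (X y)) x := by
  have h1 : ContMDiff I.tangent 𝓘(ℝ, ℝ).tangent ∞ (tangentMap I 𝓘(ℝ, ℝ) f) :=
    hf.contMDiff_tangentMap (by simp)
  have h2 := (contMDiff_snd_tangentBundle_modelSpace ℝ 𝓘(ℝ, ℝ) (n := ∞)).comp h1
  exact (h2.contMDiffAt (x := (⟨x, X x⟩ : TangentBundle I M))).comp x hX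

/-- The Lie bracket of vector fields acts on functions as the commutator. -/
theorem mvfderiv_mlieBracket [IsManifold I ∞ M] [CompleteSpace E]
    {X Y : ∀ x : M, TangentSpace I x} {f : M → ℝ}
    (hX : ContMDiff I I.tangent ∞ (fun x => (⟨x, X x⟩ : TangentBundle I M)))
    (hY : ContMDiff I I.tangent ∞ (fun x => (⟨x, Y x⟩ : TangentBundle I M)))
    (hf : ContMDiff I 𝓘(ℝ, ℝ) ∞ f) (x : M) :
    mvfderiv I f x (mlieBracket I X Y x) =
      mvfderiv I (fun y => mvfderiv I f y (Y y)) x (X x) -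
        mvfderiv I (fun y => mvfderiv I f y (X y)) x (Y x) := by
  rcases subsingleton_or_nontrivial E with hE | hE
  · have h0 : ∀ v : TangentSpace I x, v = 0 := fun v => Subsingleton.elim (α := E) v 0
    rw [h0 (mlieBracket I X Y x), h0 (X x), h0 (Y x)]
    simp
  obtain ⟨e, he⟩ := exists_ne (0 : E)
  have i2 : IsManifold I 2 M := IsManifold.of_le (n := ∞) (by norm_cast)
  have i3 : IsManifold I 3 M := IsManifold.of_le (n := ∞) (by norm_cast)
  have i4 : IsManifold I (minSmoothness ℝ 3) M := by simpa using i3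
  have i5 : IsManifold I (((⊤ : ℕ∞) : WithTop ℕ∞) + 1) M := by simpa using! ‹IsManifold I ∞ M›
  -- a smooth vector field near `x` that does not vanish at `x`
  obtain ⟨Z, hZ, hZx⟩ : ∃ Z : ∀ y : M, TangentSpace I y,
      (∀ᶠ y in 𝓝 x, ContMDiffAt I I.tangent ∞ (fun y => (⟨y, Z y⟩ : TangentBundle I M)) y) ∧
        Z x ≠ 0 := by
    obtain ⟨e', he'⟩ : ∃ e' : TangentSpace I x, e' ≠ 0 := ⟨e, he⟩
    obtain ⟨s, hs, h⟩ := FiberBundle.exists_contMDiffOn_extend I (k := ∞) E e'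
    refine ⟨FiberBundle.extend E e', ?_, ?_⟩
    · filter_upwards [eventually_mem_nhds_iff.2 hs] with y hy
      exact h.contMDiffAt hy
    · rw [FiberBundle.extend_apply_self]
      exact he'
  have two : (minSmoothness ℝ 2) ≤ (∞ : WithTop ℕ∞) := by simp; norm_cast
  have md {W : ∀ y : M, TangentSpace I y} {y : M}
      (h : ContMDiffAt I I.tangent ∞ (fun y => (⟨y, W y⟩ : TangentBundle I M)) y) :
      MDifferentiableAt I I.tangent (fun y => (⟨y, W y⟩ : TangentBundle I M)) y :=
    h.mdifferentiableAt (by simp)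
  have br {U W : ∀ y : M, TangentSpace I y} {y : M}
      (hU : ContMDiffAt I I.tangent ∞ (fun y => (⟨y, U y⟩ : TangentBundle I M)) y)
      (hW : ContMDiffAt I I.tangent ∞ (fun y => (⟨y, W y⟩ : TangentBundle I M)) y) :
      ContMDiffAt I I.tangent ∞ (fun y => (⟨y, mlieBracket I U W y⟩ : TangentBundle I M)) y :=
    hU.mlieBracket_vectorField hW (by simp)
  have hfd : ∀ y, MDifferentiableAt I 𝓘(ℝ, ℝ) f y := fun y => (hf y).mdifferentiableAt (by simp)
  have hXf : ∀ y, ContMDiffAt I 𝓘(ℝ, ℝ) ∞ (fun y => mvfderiv I f y (X y)) y :=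
    fun y => contMDiffAt_mvfderiv_apply (hX y) hf
  have hYf : ∀ y, ContMDiffAt I 𝓘(ℝ, ℝ) ∞ (fun y => mvfderiv I f y (Y y)) y :=
    fun y => contMDiffAt_mvfderiv_apply (hY y) hf
  have hZx' := hZ.self_of_nhds
  have hfZ : ContMDiffAt I I.tangent ∞ (fun y => (⟨y, (f • Z) y⟩ : TangentBundle I M)) x :=
    (hf x).smul_section hZx'
  have expand {U W : ∀ y : M, TangentSpace I y}
      (hU : ContMDiff I I.tangent ∞ (fun x => (⟨x, U x⟩ : TangentBundle I M)))
      (hW : ContMDiff I I.tangent ∞ (fun x => (⟨x, W x⟩ : TangentBundle I M))) :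
      mlieBracket I U (mlieBracket I W (f • Z)) x =
        mvfderiv I (fun y => mvfderiv I f y (W y)) x (U x) • Z x
          + mvfderiv I f x (W x) • mlieBracket I U Z x
          + (mvfderiv I f x (U x) • mlieBracket I W Z x
          + f x • mlieBracket I U (mlieBracket I W Z) x) := by
    have e1 : mlieBracket I W (f • Z) =ᶠ[𝓝 x]
        ((fun y => mvfderiv I f y (W y)) • Z + f • mlieBracket I W Z) := by
      filter_upwards [hZ] with y hy
      exact mlieBracket_smul_right (hfd y) (md hy)
    have hWf := contMDiffAt_mvfderiv_apply (hW x) hf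
    rw [Filter.EventuallyEq.mlieBracket_vectorField_eq (Filter.EventuallyEq.refl _ U) e1,
      mlieBracket_add_right (md (hWf.smul_section hZx'))
        (md ((hf x).smul_section (br (hW x) hZx'))),
      mlieBracket_smul_right (hWf.mdifferentiableAt (by simp)) (md hZx'),
      mlieBracket_smul_right (hfd x) (md (br (hW x) hZx'))]
  have j1 := leibniz_identity_mlieBracket_apply (I := I) ((hX x).of_le two) ((hY x).of_le two)
    (hfZ.of_le two)
  have j2 := leibniz_identity_mlieBracket_apply (I := I) ((hX x).of_le two) ((hY x).of_le two)
    (hZx'.of_le two)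
  rw [expand hX hY, expand hY hX, mlieBracket_smul_right (hfd x) (md hZx'), j2] at j1
  have key : (mvfderiv I f x (mlieBracket I X Y x) -
      (mvfderiv I (fun y => mvfderiv I f y (Y y)) x (X x) -
        mvfderiv I (fun y => mvfderiv I f y (X y)) x (Y x))) • Z x = 0 := by
    rw [sub_smul, sub_smul]
    rw [smul_add] at j1
    rw [← sub_eq_zero] at j1
    rw [← neg_eq_zero, ← j1]
    abel
  have := (smul_eq_zero.1 key).resolve_right hZx
  linarith

/-- A smooth vector field applied to a smooth function. -/
def fieldApply [IsManifold I ∞ M] (X : ∀ x : M, TangentSpace I x) (hX : SmoothFieldOn X Set.univ)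
    (f : C^∞⟮I, M; ℝ⟯) : C^∞⟮I, M; ℝ⟯ :=
  ⟨fun x => mvfderiv I f x (X x),
    fun x => contMDiffAt_mvfderiv_apply (contMDiffOn_univ.1 hX x) f.contMDiff⟩

theorem coe_fieldApply [IsManifold I ∞ M] (X : ∀ x : M, TangentSpace I x)
    (hX : SmoothFieldOn X Set.univ) (f : C^∞⟮I, M; ℝ⟯) :
    ⇑(fieldApply X hX f) = fun x => mvfderiv I f x (X x) := rfl

end VectorFields

/-! ### Lie algebroids -/

/-- The data underlying a Lie algebroid over `M`: a family of real vector spaces, the notion of a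
smooth local section, an anchor, and a bracket of sections (which is only relevant for smooth
global sections). The axioms are stated in `AlgebroidData.IsLieAlgebroid`. -/
structure AlgebroidData {E : Type*} [NormedAddCommGroup E] [NormedSpace ℝ E] {H : Type*}
    [TopologicalSpace H] (I : ModelWithCorners ℝ E H) (M : Type*) [TopologicalSpace M]
    [ChartedSpace H M] where
  /-- the fibres -/
  Fib : M → Type*
  [addCommGroup : ∀ x, AddCommGroup (Fib x)]
  [module : ∀ x, Module ℝ (Fib x)]
  /-- `SmoothOn U s`: over the open set `U`, the section `s` is smooth -/
  SmoothOn : Set M → (∀ x, Fib x) → Prop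
  /-- the anchor -/
  anchor : ∀ x, Fib x →ₗ[ℝ] TangentSpace I x
  /-- the bracket of sections -/
  bracket : (∀ x, Fib x) → (∀ x, Fib x) → (∀ x, Fib x)

attribute [instance] AlgebroidData.addCommGroup AlgebroidData.module

namespace AlgebroidData

variable {E : Type*} [NormedAddCommGroup E] [NormedSpace ℝ E] {H : Type*}
  [TopologicalSpace H] {I : ModelWithCorners ℝ E H} {M : Type*} [TopologicalSpace M]
  [ChartedSpace H M]

/-- Smooth global sections. -/
def IsSection (A : AlgebroidData I M) (s : ∀ x, A.Fib x) : Prop := A.SmoothOn Set.univ s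

/-- The fibres are those of a smooth vector bundle of finite rank over `M`, whose smooth sections
over open sets are the prescribed ones. -/
def IsSmoothVectorBundle (A : AlgebroidData I M) : Prop :=
  ∃ (r : ℕ) (_ : ∀ x, TopologicalSpace (A.Fib x))
    (_ : TopologicalSpace (TotalSpace (EuclideanSpace ℝ (Fin r)) A.Fib))
    (_ : FiberBundle (EuclideanSpace ℝ (Fin r)) A.Fib)
    (_ : VectorBundle ℝ (EuclideanSpace ℝ (Fin r)) A.Fib),
    ContMDiffVectorBundle ∞ (EuclideanSpace ℝ (Fin r)) A.Fib I ∧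
      ∀ U : Set M, IsOpen U → ∀ s : ∀ x, A.Fib x,
        A.SmoothOn U s ↔ ContMDiffOn I (I.prod 𝓘(ℝ, EuclideanSpace ℝ (Fin r))) ∞
          (fun x => (⟨x, s x⟩ : TotalSpace (EuclideanSpace ℝ (Fin r)) A.Fib)) U

/-- The axioms of a Lie algebroid. -/
structure IsLieAlgebroid [IsManifold I ∞ M] (A : AlgebroidData I M) : Prop where
  isSmoothVectorBundle : A.IsSmoothVectorBundle
  anchor_smooth : ∀ U : Set M, IsOpen U → ∀ s, A.SmoothOn U s →
    SmoothFieldOn (fun x => A.anchor x (s x)) U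
  bracket_smooth : ∀ s t, A.IsSection s → A.IsSection t → A.IsSection (A.bracket s t)
  bracket_add : ∀ r s t, A.IsSection r → A.IsSection s → A.IsSection t →
    A.bracket r (s + t) = A.bracket r s + A.bracket r t
  bracket_smul : ∀ (c : ℝ) (s t), A.IsSection s → A.IsSection t →
    A.bracket s (c • t) = c • A.bracket s t
  bracket_skew : ∀ s t, A.IsSection s → A.IsSection t → A.bracket s t = -A.bracket t s
  jacobi : ∀ r s t, A.IsSection r → A.IsSection s → A.IsSection t →
    A.bracket r (A.bracket s t) + A.bracket s (A.bracket t r) + A.bracket t (A.bracket r s) = 0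
  leibniz : ∀ (s t) (f : C^∞⟮I, M; ℝ⟯), A.IsSection s → A.IsSection t → ∀ x,
    A.bracket s (fun y => f y • t y) x =
      f x • A.bracket s t x + mvfderiv I f x (A.anchor x (s x)) • t x
  anchor_bracket : ∀ s t, A.IsSection s → A.IsSection t → ∀ x,
    A.anchor x (A.bracket s t x) =
      mlieBracket I (fun y => A.anchor y (s y)) (fun y => A.anchor y (t y)) x

/-- An isomorphism of Lie algebroids over the identity of `M`: an isomorphism of smooth vector
bundles which preserves the anchors and the brackets of sections. -/
structure Iso (A B : AlgebroidData I M) where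
  /-- the isomorphisms of fibres -/
  equiv : ∀ x, A.Fib x ≃ₗ[ℝ] B.Fib x
  smooth_iff : ∀ U : Set M, IsOpen U → ∀ s : ∀ x, A.Fib x,
    A.SmoothOn U s ↔ B.SmoothOn U (fun x => equiv x (s x))
  map_anchor : ∀ x (a : A.Fib x), B.anchor x (equiv x a) = A.anchor x a
  map_bracket : ∀ s t, A.IsSection s → A.IsSection t → ∀ x,
    equiv x (A.bracket s t x) = B.bracket (fun y => equiv y (s y)) (fun y => equiv y (t y)) x

end AlgebroidData

/-! ### The Lie algebroid of derivations of a vector bundle -/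

section Derivations

variable {E : Type*} [NormedAddCommGroup E] [NormedSpace ℝ E] {H : Type*}
  [TopologicalSpace H] (I : ModelWithCorners ℝ E H) {M : Type*} [TopologicalSpace M]
  [ChartedSpace H M]
  (V : Type*) [NormedAddCommGroup V] [NormedSpace ℝ V]
  (F : M → Type*) [TopologicalSpace (TotalSpace V F)] [∀ x, AddCommGroup (F x)]
  [∀ x, Module ℝ (F x)] [∀ x, TopologicalSpace (F x)] [FiberBundle V F] [VectorBundle ℝ V F]

/-- The product of a smooth function and a smooth section. -/
def smulSection (f : C^∞⟮I, M; ℝ⟯) (s : Cₛ^∞⟮I; V, F⟯) : Cₛ^∞⟮I; V, F⟯ :=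
  ⟨fun x => f x • s x, f.contMDiff.smul_section s.contMDiff⟩

/-- The fibre at `x` of the bundle of derivations of `F`: the pairs of an `ℝ`-linear map
`δ : Γ F → F x` and a tangent vector `v` at `x` (the symbol of `δ`) such that
`δ (f s) = f x • δ s + (v f) • s x`. -/
def DerivationFibre (x : M) : Submodule ℝ ((Cₛ^∞⟮I; V, F⟯ →ₗ[ℝ] F x) × TangentSpace I x) where
  carrier := {d | ∀ (f : C^∞⟮I, M; ℝ⟯) (s : Cₛ^∞⟮I; V, F⟯),
    d.1 (smulSection I V F f s) = f x • d.1 s + mvfderiv I f x d.2 • s x}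
  add_mem' := by
    intro a b ha hb f s
    simp only [Prod.fst_add, Prod.snd_add, LinearMap.add_apply, ha f s, hb f s, map_add, smul_add,
      add_smul]
    abel
  zero_mem' := by
    intro f s
    simp
  smul_mem' := by
    intro c a ha f s
    simp only [Prod.smul_fst, Prod.smul_snd, LinearMap.smul_apply, ha f s, map_smul, smul_add,
      smul_eq_mul, mul_smul]
    rw [smul_comm c (f x)]

variable {I V F}

/-- A section `d` of the bundle of derivations is smooth on `U` if it sends smooth sections of `F`
to sections that are smooth on `U`, and if its symbol is smooth on `U`. -/
def DerivationSmoothOn [IsManifold I ∞ M] (U : Set M) (d : ∀ x, DerivationFibre I V F x) : Prop :=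
  (∀ s : Cₛ^∞⟮I; V, F⟯, ContMDiffOn I (I.prod 𝓘(ℝ, V)) ∞
    (fun x => (⟨x, (d x).1.1 s⟩ : TotalSpace V F)) U) ∧
  SmoothFieldOn (fun x => (d x).1.2) U

/-- The derivative endomorphism of `Γ F` defined by a smooth section of the bundle of
derivations. -/
def derivationOperator [IsManifold I ∞ M] (d : ∀ x, DerivationFibre I V F x)
    (hd : DerivationSmoothOn Set.univ d) : Cₛ^∞⟮I; V, F⟯ →ₗ[ℝ] Cₛ^∞⟮I; V, F⟯ where
  toFun s := ⟨fun x => (d x).1.1 s, contMDiffOn_univ.1 (hd.1 s)⟩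
  map_add' s t := by ext x; exact (d x).1.1.map_add s t
  map_smul' c s := by ext x; exact (d x).1.1.map_smul c s

/-- The commutator of two smooth sections of the bundle of derivations. -/
def derivationCommutator [IsManifold I ∞ M] [CompleteSpace E] (d₁ d₂ : ∀ x, DerivationFibre I V F x)
    (h₁ : DerivationSmoothOn Set.univ d₁) (h₂ : DerivationSmoothOn Set.univ d₂) (x : M) :
    DerivationFibre I V F x :=
  ⟨((d₁ x).1.1 ∘ₗ derivationOperator d₂ h₂ - (d₂ x).1.1 ∘ₗ derivationOperator d₁ h₁,
    mlieBracket I (fun y => (d₁ y).1.2) (fun y => (d₂ y).1.2) x), by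
    intro f s
    have e₁ : derivationOperator d₁ h₁ (smulSection I V F f s) =
        smulSection I V F f (derivationOperator d₁ h₁ s) +
          smulSection I V F (fieldApply _ h₁.2 f) s := by
      ext y
      exact (d₁ y).2 f s
    have e₂ : derivationOperator d₂ h₂ (smulSection I V F f s) =
        smulSection I V F f (derivationOperator d₂ h₂ s) +
          smulSection I V F (fieldApply _ h₂.2 f) s := by
      ext y
      exact (d₂ y).2 f s
    have hb := mvfderiv_mlieBracket (contMDiffOn_univ.1 h₁.2) (contMDiffOn_univ.1 h₂.2)
      f.contMDiff x
    have k₁ : (derivationOperator d₁ h₁ s) x = (d₁ x).1.1 s := rfl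
    have k₂ : (derivationOperator d₂ h₂ s) x = (d₂ x).1.1 s := rfl
    have a₁ := (d₁ x).2
    have a₂ := (d₂ x).2
    simp only [LinearMap.sub_apply, LinearMap.comp_apply, e₁, e₂, map_add]
    rw [a₁, a₁, a₂, a₂, k₁, k₂, hb, smul_sub, sub_smul]
    simp only [coe_fieldApply]
    abel⟩

variable (I V F)

open Classical in
/-- The Lie algebroid of derivations of `F`: the anchor is the symbol and the bracket is the
commutator. -/
def derivationAlgebroid [IsManifold I ∞ M] [CompleteSpace E] : AlgebroidData I M where
  Fib x := DerivationFibre I V F x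
  SmoothOn := DerivationSmoothOn
  anchor x := LinearMap.snd ℝ _ _ ∘ₗ (DerivationFibre I V F x).subtype
  bracket d₁ d₂ :=
    if h : DerivationSmoothOn Set.univ d₁ ∧ DerivationSmoothOn Set.univ d₂ then
      derivationCommutator d₁ d₂ h.1 h.2
    else 0

end Derivations

/-! ### The pull-back of a Lie algebroid -/

namespace AlgebroidData

variable {E : Type*} [NormedAddCommGroup E] [NormedSpace ℝ E] {H : Type*}
  [TopologicalSpace H] {I : ModelWithCorners ℝ E H} {M : Type*} [TopologicalSpace M]
  [ChartedSpace H M]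
  {E' : Type*} [NormedAddCommGroup E'] [NormedSpace ℝ E'] {H' : Type*}
  [TopologicalSpace H'] {J : ModelWithCorners ℝ E' H'} {N : Type*} [TopologicalSpace N]
  [ChartedSpace H' N]
  (B : AlgebroidData J N) (φ : C^∞⟮I, M; J, N⟯)

/-- The fibre at `m` of the fibre product of `B` and `TM` over `TN`: the pairs `(b, u)` of
`b ∈ B_{φ m}` and `u ∈ T_m M` such that `ρ_B b = (Tφ) u`. -/
def PullbackFibre (m : M) : Submodule ℝ (B.Fib (φ m) × TangentSpace I m) where
  carrier := {p | B.anchor (φ m) p.1 = mfderiv I J φ m p.2}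
  add_mem' := by
    intro a b ha hb
    simp only [Set.mem_ofPred_eq] at ha hb ⊢
    rw [Prod.fst_add, Prod.snd_add, map_add, map_add, ha, hb]
  zero_mem' := by simp
  smul_mem' := by
    intro c a ha
    simp only [Set.mem_ofPred_eq] at ha ⊢
    rw [Prod.smul_fst, Prod.smul_snd, map_smul, map_smul, ha]

/-- The map `φ` is admissible for `B` if the fibre product of `B` and `TM` over `TN` has constant
rank. -/
def Admissible : Prop :=
  ∃ r : ℕ, ∀ m, Module.Finite ℝ (PullbackFibre B φ m) ∧
    Module.finrank ℝ (PullbackFibre B φ m) = r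

/-- Near `m`, the section `σ` of the pull-back of the vector bundle `B` is `∑ i, f i ⊗ b i`, with
smooth functions `f i` on `M` and smooth sections `b i` of `B`. -/
def RepresentsNear (σ : ∀ m, B.Fib (φ m)) (m : M) {k : ℕ} (f : Fin k → C^∞⟮I, M; ℝ⟯)
    (b : Fin k → ∀ y, B.Fib y) : Prop :=
  (∀ i, B.IsSection (b i)) ∧ ∀ᶠ x in 𝓝 m, σ x = ∑ i, f i x • b i (φ x)

/-- Smoothness of a section of the fibre product, as a sub-bundle of the direct sum of the
pull-back of the vector bundle `B` and of `TM`. -/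
def PullbackSmoothOn [IsManifold I ∞ M] (U : Set M) (s : ∀ m, PullbackFibre B φ m) : Prop :=
  (∀ m ∈ U, ∃ (k : ℕ) (f : Fin k → C^∞⟮I, M; ℝ⟯) (b : Fin k → ∀ y, B.Fib y),
    RepresentsNear B φ (fun x => (s x).1.1) m f b) ∧
  SmoothFieldOn (fun x => (s x).1.2) U

/-- The value `w` at `m` of the bracket of the sections `s = (σ, u)` and `t = (τ, v)` of the
pull-back: `w = (∑ f_i g_j [b_i, c_j] + ∑ (u g_j) c_j - ∑ (v f_i) b_i, [u, v])` whenever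
`σ = ∑ f_i ⊗ b_i` and `τ = ∑ g_j ⊗ c_j` near `m`. -/
def IsPullbackBracketAt (s t : ∀ m, PullbackFibre B φ m) (m : M) (w : PullbackFibre B φ m) :
    Prop :=
  (∀ (k l : ℕ) (f : Fin k → C^∞⟮I, M; ℝ⟯) (b : Fin k → ∀ y, B.Fib y)
    (g : Fin l → C^∞⟮I, M; ℝ⟯) (c : Fin l → ∀ y, B.Fib y),
    RepresentsNear B φ (fun x => (s x).1.1) m f b →
    RepresentsNear B φ (fun x => (t x).1.1) m g c →
    w.1.1 = ∑ i, ∑ j, (f i m * g j m) • B.bracket (b i) (c j) (φ m)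
      + ∑ j, mvfderiv I (g j) m (s m).1.2 • c j (φ m)
      - ∑ i, mvfderiv I (f i) m (t m).1.2 • b i (φ m)) ∧
  w.1.2 = mlieBracket I (fun x => (s x).1.2) (fun x => (t x).1.2) m

/-- The formula for the bracket of sections of the pull-back defines exactly one value at each
point, independently of the representations that are used. -/
def PullbackBracketWellDefined [IsManifold I ∞ M] : Prop :=
  ∀ s t : ∀ m, PullbackFibre B φ m,
    PullbackSmoothOn B φ Set.univ s → PullbackSmoothOn B φ Set.univ t →
      ∀ m, ∃! w, IsPullbackBracketAt B φ s t m w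

/-- The pull-back of `B` by `φ`: the anchor is the second projection, and the value of the bracket
of two sections at a point is the one given by the formula in `IsPullbackBracketAt`. -/
def pullback [IsManifold I ∞ M] : AlgebroidData I M where
  Fib m := PullbackFibre B φ m
  SmoothOn := PullbackSmoothOn B φ
  anchor m := LinearMap.snd ℝ _ _ ∘ₗ (PullbackFibre B φ m).subtype
  bracket s t m := Classical.epsilon (IsPullbackBracketAt B φ s t m)

end AlgebroidData

/-- The fibres of the pull-back of a vector bundle are additive groups. -/
instance pullbackFibreAddCommGroup {B B' : Type*} (f : B' → B) (F : B → Type*)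
    [i : ∀ x, AddCommGroup (F x)] (x : B') : AddCommGroup ((f *ᵖ F) x) :=
  inferInstanceAs (AddCommGroup (F (f x)))

end

/-!
# Derivations of a pull-back bundle

The argument rests on the locality of derivations. Multiplying by a bump function shows that
`δ s` depends only on the germ of `s` (`derivation_congr`). Hence a derivation at `x` is determined
by its symbol and by its values on a local frame of `F`, and these data can be prescribed
arbitrarily (`derivation_apply_eq_sum`, `exists_derivation`). They are therefore linear coordinates
on the fibres of the bundle `D F` of derivations. These coordinates are compatible with the given
notion of smoothness, so `D F` is a vector bundle (`isSmoothVectorBundle_of_coordinates`,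
`derivationAlgebroid_isSmoothVectorBundle`). The remaining Lie algebroid axioms are identities
between commutators of operators and the corresponding ones for vector fields.

For a smooth map `φ : M → N`, restricting a derivation `(δ, u)` of `φ^* F` at `m` to the pulled-back
sections `s ∘ φ` gives a derivation of `F` at `φ m` whose symbol is `(Tφ) u`
(`restrictDerivation`). Since a frame of `F` pulls back to a frame of `φ^* F`, the map
`d ↦ (restriction of d, u)` is a bijection from the fibre of `D (φ^* F)` onto the fibre product
(`bijective_derivationToPullback`). All the fibres of `D (φ^* F)` have the same dimension, whence
admissibility. Smooth sections correspond to smooth sections: the restriction of a smooth family of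
derivations has smooth coefficients in a frame of `D F`, and conversely a combination
`∑ f_i ⊗ b_i` sends pulled-back sections to smooth sections
(`derivationSmoothOn_iff_pullbackSmoothOn`).

The brackets are compared by evaluating the commutator of two derivations of `φ^* F` on a
pulled-back section. If the restrictions are `∑ f_i ⊗ b_i` and `∑ g_j ⊗ c_j`, the Leibniz rule gives
exactly the terms of the bracket formula; the equality of the symbols is checked on functions of the
form `h ∘ φ` in the same way (`isPullbackBracketAt_commutator`). So the commutator is a value of the
bracket formula for every choice of local representations. As representations exist, it is the only
one: the bracket is well defined, it is preserved by the isomorphism, and the axioms for the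
pull-back follow from those for `D (φ^* F)` (`AlgebroidData.IsLieAlgebroid.of_iso`).
-/

noncomputable section

set_option linter.unusedSectionVars false

/-! ### Vector bundles from linear coordinates -/

section ClmSmooth

variable {E : Type*} [NormedAddCommGroup E] [NormedSpace ℝ E] {H : Type*} [TopologicalSpace H]
  {I : ModelWithCorners ℝ E H} {M : Type*} [TopologicalSpace M] [ChartedSpace H M]

/-- A family of continuous linear maps on a finite-dimensional space is smooth if its values on
constant vectors are. -/
theorem contMDiffOn_clm_of_apply {W G : Type*} [NormedAddCommGroup W] [NormedSpace ℝ W]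
    [FiniteDimensional ℝ W] [NormedAddCommGroup G] [NormedSpace ℝ G] {f : M → W →L[ℝ] G}
    {S : Set M} (h : ∀ w, ContMDiffOn I 𝓘(ℝ, G) ∞ (fun x => f x w) S) :
    ContMDiffOn I 𝓘(ℝ, W →L[ℝ] G) ∞ f S := by
  let b := Module.finBasis ℝ W
  have e : f = fun x => ∑ i, (ContinuousLinearMap.smulRightL ℝ W G
      (LinearMap.toContinuousLinearMap (b.coord i))) (f x (b i)) := by
    funext x
    refine ContinuousLinearMap.coe_injective (b.ext fun j => ?_)
    simp [Finsupp.single_apply]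
  rw [e]
  refine contMDiffOn_finsetSum fun i _ => ?_
  exact (ContinuousLinearMap.contMDiff _).comp_contMDiffOn (h (b i))

end ClmSmooth

namespace AlgebroidData

variable {E : Type*} [NormedAddCommGroup E] [NormedSpace ℝ E] {H : Type*}
  [TopologicalSpace H] {I : ModelWithCorners ℝ E H} {M : Type*} [TopologicalSpace M]
  [ChartedSpace H M]

/-- Smooth sections of `A` form a sheaf: smoothness passes to smaller open sets, and holds on an
open set as soon as it holds near each of its points. -/
structure IsLocal (A : AlgebroidData I M) : Prop where
  mono : ∀ W W' : Set M, IsOpen W → IsOpen W' → W' ⊆ W → ∀ s, A.SmoothOn W s → A.SmoothOn W' s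
  glue : ∀ W : Set M, IsOpen W → ∀ s,
    (∀ x ∈ W, ∃ W', IsOpen W' ∧ x ∈ W' ∧ A.SmoothOn W' s) → A.SmoothOn W s

/-- Linear trivializations over open neighbourhoods `U x₀` of the points `x₀`, for which a local
section is smooth exactly when its image is, make `A` a smooth vector bundle. The topologies of the
fibres and of the total space come from a vector prebundle. The smoothness of the transition maps is
not a hypothesis: it holds because sections with constant coordinates are smooth. -/
theorem isSmoothVectorBundle_of_trivializations (A : AlgebroidData I M) (hA : A.IsLocal) {r : ℕ}
    (U : M → Set M) (hU : ∀ x, IsOpen (U x)) (hx : ∀ x, x ∈ U x)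
    (e : M → ∀ x, A.Fib x ≃ₗ[ℝ] EuclideanSpace ℝ (Fin r))
    (he : ∀ x₀ W, IsOpen W → W ⊆ U x₀ → ∀ s, A.SmoothOn W s ↔
      ContMDiffOn I 𝓘(ℝ, EuclideanSpace ℝ (Fin r)) ∞ (fun x => e x₀ x (s x)) W) :
    A.IsSmoothVectorBundle := by
  let V := EuclideanSpace ℝ (Fin r)
  let p : M → Pretrivialization V (π V A.Fib) := fun x₀ =>
    { toFun := fun z => (z.1, e x₀ z.1 z.2)
      invFun := fun z => ⟨z.1, (e x₀ z.1).symm z.2⟩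
      source := π V A.Fib ⁻¹' U x₀
      target := U x₀ ×ˢ Set.univ
      map_source' := fun z hz => ⟨hz, trivial⟩
      map_target' := fun z hz => hz.1
      left_inv' := fun z _ => by simp
      right_inv' := fun z _ => by simp
      open_target := (hU x₀).prod isOpen_univ
      baseSet := U x₀
      open_baseSet := hU x₀
      source_eq := rfl
      target_eq := rfl
      proj_toFun := fun _ _ => rfl }
  have hp : ∀ x₀ z, p x₀ z = (z.1, e x₀ z.1 z.2) := fun _ _ => rfl
  have psymm : ∀ x₀ x, x ∈ U x₀ → ∀ v, (p x₀).symm x v = (e x₀ x).symm v := by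
    intro x₀ x h v
    apply (e x₀ x).injective
    have := (p x₀).apply_mk_symm (b := x) h v
    rw [hp] at this
    simpa using congrArg Prod.snd this
  let f : M → M → M → V →L[ℝ] V := fun x₀ x₁ x =>
    LinearMap.toContinuousLinearMap ((e x₁ x).toLinearMap ∘ₗ (e x₀ x).symm.toLinearMap)
  have hf : ∀ x₀ x₁, ContMDiffOn I 𝓘(ℝ, V →L[ℝ] V) ∞ (f x₀ x₁) (U x₀ ∩ U x₁) := by
    intro x₀ x₁
    refine contMDiffOn_clm_of_apply fun v => ?_
    -- the section with constant coordinates `v` in the first trivialization is smooth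
    have h0 := (he x₀ (U x₀ ∩ U x₁) ((hU x₀).inter (hU x₁)) Set.inter_subset_left
      (fun x => (e x₀ x).symm v)).2 (by simpa using contMDiffOn_const)
    exact (he x₁ _ ((hU x₀).inter (hU x₁)) Set.inter_subset_right _).1 h0
  let : ∀ x, TopologicalSpace (A.Fib x) := fun x => .induced (e x x) inferInstance
  let a : VectorPrebundle ℝ V A.Fib :=
    { pretrivializationAtlas := Set.range p
      pretrivialization_linear' := by
        rintro _ ⟨x₀, rfl⟩
        exact ⟨fun x _ => { map_add := (e x₀ x).map_add, map_smul := (e x₀ x).map_smul }⟩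
      pretrivializationAt := p
      mem_base_pretrivializationAt := hx
      pretrivialization_mem_atlas := fun x => ⟨x, rfl⟩
      exists_coordChange := by
        rintro _ ⟨x₀, rfl⟩ _ ⟨x₁, rfl⟩
        refine ⟨f x₀ x₁, (hf x₀ x₁).continuousOn, fun x hx v => ?_⟩
        rw [psymm x₀ x hx.1]
        rfl
      totalSpaceMk_isInducing := fun x => by
        have h1 : Topology.IsInducing (fun w : A.Fib x => e x x w) := ⟨rfl⟩
        have h2 : Topology.IsInducing (fun v : V => (x, v)) :=
          (isEmbedding_prodMkRight x).isInducing
        exact h2.comp h1 }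
  have : a.IsContMDiff I ∞ := ⟨by
    rintro _ ⟨x₀, rfl⟩ _ ⟨x₁, rfl⟩
    refine ⟨f x₀ x₁, hf x₀ x₁, fun x hx v => ?_⟩
    rw [psymm x₀ x hx.1]
    rfl⟩
  let := a.totalSpaceTopology
  let := a.toFiberBundle
  have := a.toVectorBundle
  have : ContMDiffVectorBundle ∞ V A.Fib I := a.contMDiffVectorBundle I
  have key : ∀ x₀ W, IsOpen W → W ⊆ U x₀ → ∀ s, A.SmoothOn W s ↔
      ContMDiffOn I (I.prod 𝓘(ℝ, V)) ∞ (fun x => (⟨x, s x⟩ : TotalSpace V A.Fib)) W := by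
    intro x₀ W hW hWU s
    rw [he x₀ W hW hWU s, (trivializationAt V A.Fib x₀).contMDiffOn_iff
      (fun x hx => ((trivializationAt V A.Fib x₀).mem_source).2 (hWU hx))]
    exact ⟨fun h => ⟨contMDiffOn_id, h⟩, fun h => h.2⟩
  refine ⟨r, inferInstance, inferInstance, inferInstance, inferInstance, inferInstance,
    fun W hW s => ?_⟩
  constructor
  · intro h x hxW
    have hWU := hA.mono W (W ∩ U x) hW (hW.inter (hU x)) Set.inter_subset_left s h
    exact (((key x _ (hW.inter (hU x)) Set.inter_subset_right s).1 hWU).contMDiffAt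
      ((hW.inter (hU x)).mem_nhds ⟨hxW, hx x⟩)).contMDiffWithinAt
  · intro h
    refine hA.glue W hW s fun x hxW => ⟨W ∩ U x, hW.inter (hU x), ⟨hxW, hx x⟩, ?_⟩
    exact (key x _ (hW.inter (hU x)) Set.inter_subset_right s).2 (h.mono Set.inter_subset_left)

/-- Linear coordinates with values in `ι → ℝ`, bijective on the fibres over a neighbourhood of each
point and compatible with smoothness, make `A` a smooth vector bundle. -/
theorem isSmoothVectorBundle_of_coordinates (A : AlgebroidData I M) (hA : A.IsLocal)
    {ι : Type*} [Fintype ι] (U : M → Set M) (hU : ∀ x, IsOpen (U x)) (hx : ∀ x, x ∈ U x)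
    (c : M → ∀ x, A.Fib x →ₗ[ℝ] (ι → ℝ))
    (hc : ∀ x₀, ∀ x ∈ U x₀, Function.Bijective (c x₀ x))
    (he : ∀ x₀ W, IsOpen W → W ⊆ U x₀ → ∀ s, A.SmoothOn W s ↔
      ∀ i, ContMDiffOn I 𝓘(ℝ, ℝ) ∞ (fun x => c x₀ x (s x) i) W) :
    A.IsSmoothVectorBundle := by
  classical
  let L : (ι → ℝ) ≃L[ℝ] EuclideanSpace ℝ (Fin (Fintype.card ι)) :=
    ContinuousLinearEquiv.ofFinrankEq (by simp)
  let e : M → ∀ x, A.Fib x ≃ₗ[ℝ] EuclideanSpace ℝ (Fin (Fintype.card ι)) := fun x₀ x =>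
    if h : x ∈ U x₀ then (LinearEquiv.ofBijective _ (hc x₀ x h)).trans L.toLinearEquiv
    else (LinearEquiv.ofBijective _ (hc x x (hx x))).trans L.toLinearEquiv
  have hex : ∀ x₀ x, x ∈ U x₀ → ∀ a, e x₀ x a = L (c x₀ x a) := by
    intro x₀ x h a
    simp [e, h]
  refine A.isSmoothVectorBundle_of_trivializations hA U hU hx e fun x₀ W hW hWU s => ?_
  rw [he x₀ W hW hWU s, contMDiffOn_congr (fun x hxW => hex x₀ x (hWU hxW) (s x)),
    ← contMDiffOn_pi_space]
  constructor
  · intro h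
    exact L.toContinuousLinearMap.contMDiff.comp_contMDiffOn h
  · intro h
    have := L.symm.toContinuousLinearMap.contMDiff.comp_contMDiffOn h
    simpa [Function.comp_def] using this

end AlgebroidData

/-! ### Extension of germs and local frames -/

section Frames

variable {E : Type*} [NormedAddCommGroup E] [NormedSpace ℝ E] {H : Type*}
  [TopologicalSpace H] {I : ModelWithCorners ℝ E H} {M : Type*} [TopologicalSpace M]
  [ChartedSpace H M]
  {V : Type*} [NormedAddCommGroup V] [NormedSpace ℝ V]
  {F : M → Type*} [TopologicalSpace (TotalSpace V F)] [∀ x, AddCommGroup (F x)]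
  [∀ x, Module ℝ (F x)] [∀ x, TopologicalSpace (F x)] [FiberBundle V F] [VectorBundle ℝ V F]

section Extension

variable [FiniteDimensional ℝ E] [IsManifold I ∞ M] [T2Space M]

/-- Smooth bump functions, without reference to their construction. -/
theorem exists_smooth_eventuallyEq_one {U : Set M} (hU : IsOpen U) {x : M} (hx : x ∈ U) :
    ∃ f : C^∞⟮I, M; ℝ⟯, (∀ᶠ y in 𝓝 x, f y = 1) ∧ tsupport f ⊆ U := by
  obtain ⟨f, -, hf⟩ := (SmoothBumpFunction.nhds_basis_tsupport (I := I) x).mem_iff.1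
    (hU.mem_nhds hx)
  exact ⟨⟨f, f.contMDiff⟩, f.eventuallyEq_one, hf⟩

/-- Every germ of a smooth function is the germ of a global one. -/
theorem exists_contMDiffMap_eventuallyEq {U : Set M} (hU : IsOpen U) {x : M} (hx : x ∈ U)
    {g : M → ℝ} (hg : ContMDiffOn I 𝓘(ℝ, ℝ) ∞ g U) :
    ∃ f : C^∞⟮I, M; ℝ⟯, ⇑f =ᶠ[𝓝 x] g := by
  obtain ⟨f, h1, hf⟩ := exists_smooth_eventuallyEq_one (I := I) hU hx
  refine ⟨⟨fun y => f y * g y, contMDiff_of_tsupport fun y hy => ?_⟩, ?_⟩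
  · have hyf : y ∈ tsupport f := closure_mono (Function.support_mul_subset_left _ _) hy
    exact (f.contMDiff y).mul (hg.contMDiffAt (hU.mem_nhds (hf hyf)))
  · filter_upwards [h1] with y hy
    change f y * g y = g y
    rw [hy, one_mul]

/-- Every germ of a smooth section is the germ of a global one. -/
theorem exists_contMDiffSection_eventuallyEq {U : Set M} (hU : IsOpen U) {x : M} (hx : x ∈ U)
    {t : ∀ y, F y}
    (ht : ContMDiffOn I (I.prod 𝓘(ℝ, V)) ∞ (fun y => (⟨y, t y⟩ : TotalSpace V F)) U) :
    ∃ s : Cₛ^∞⟮I; V, F⟯, ∀ᶠ y in 𝓝 x, s y = t y := by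
  obtain ⟨f, h1, hf⟩ := exists_smooth_eventuallyEq_one (I := I) hU hx
  refine ⟨⟨⇑f • t, ContMDiffOn.smul_section_of_tsupport f.contMDiff.contMDiffOn hU hf ht⟩, ?_⟩
  filter_upwards [h1] with y hy
  change f y • t y = t y
  rw [hy, one_smul]

end Extension

variable (V F)

/-- The coefficients of a vector in the frame which corresponds to the standard basis of `V` under
the preferred trivialization of `F` at `x₀`; they are zero outside of its base set. -/
def frameCoeff (x₀ : M) (i : Fin (Module.finrank ℝ V)) [FiniteDimensional ℝ V] (x : M) :
    F x →ₗ[ℝ] ℝ :=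
  (Module.finBasis ℝ V).coord i ∘ₗ (trivializationAt V F x₀).linearMapAt ℝ x

variable [FiniteDimensional ℝ V] {V F}

theorem frameCoeff_apply {x₀ x : M} (hx : x ∈ (trivializationAt V F x₀).baseSet)
    (i : Fin (Module.finrank ℝ V)) (w : F x) :
    frameCoeff V F x₀ i x w = (Module.finBasis ℝ V).repr (trivializationAt V F x₀ ⟨x, w⟩).2 i := by
  rw [frameCoeff, LinearMap.comp_apply, Trivialization.coe_linearMapAt_of_mem _ hx]
  rfl

theorem bijective_frameCoeff {x₀ x : M} (hx : x ∈ (trivializationAt V F x₀).baseSet) :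
    Function.Bijective (fun (w : F x) i => frameCoeff V F x₀ i x w) := by
  have h := (((trivializationAt V F x₀).linearEquivAt ℝ x hx).trans
    (Module.finBasis ℝ V).equivFun).bijective
  convert h using 1
  funext w i
  rw [frameCoeff_apply hx]
  rfl

theorem frameCoeff_ext {x₀ x : M} (hx : x ∈ (trivializationAt V F x₀).baseSet) {w w' : F x}
    (h : ∀ i, frameCoeff V F x₀ i x w = frameCoeff V F x₀ i x w') : w = w' :=
  (bijective_frameCoeff hx).1 (funext h)

/-- The coefficients are smooth along smooth maps into the total space, hence also for sections of
`F` along a map from another manifold. -/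
theorem contMDiffOn_frameCoeff_of_map [ContMDiffVectorBundle ∞ V F I] {E₁ : Type*}
    [NormedAddCommGroup E₁] [NormedSpace ℝ E₁] {H₁ : Type*} [TopologicalSpace H₁]
    {I₁ : ModelWithCorners ℝ E₁ H₁} {M₁ : Type*} [TopologicalSpace M₁] [ChartedSpace H₁ M₁]
    {x₀ : M} {f : M₁ → TotalSpace V F} {W : Set M₁}
    (hf : ContMDiffOn I₁ (I.prod 𝓘(ℝ, V)) ∞ f W)
    (hW : ∀ x ∈ W, (f x).1 ∈ (trivializationAt V F x₀).baseSet)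
    (i : Fin (Module.finrank ℝ V)) :
    ContMDiffOn I₁ 𝓘(ℝ, ℝ) ∞ (fun x => frameCoeff V F x₀ i (f x).1 (f x).2) W := by
  have h := (((trivializationAt V F x₀).contMDiffOn_iff
    (fun x hx => ((trivializationAt V F x₀).mem_source).2 (hW x hx))).1 hf).2
  refine ContMDiffOn.congr ?_ fun x hx => frameCoeff_apply (hW x hx) i (f x).2
  exact (LinearMap.toContinuousLinearMap ((Module.finBasis ℝ V).coord i)).contMDiff.comp_contMDiffOn
    h

theorem contMDiffOn_section_iff_frameCoeff [ContMDiffVectorBundle ∞ V F I] {x₀ : M} {W : Set M}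
    (hW : W ⊆ (trivializationAt V F x₀).baseSet) (t : ∀ x, F x) :
    ContMDiffOn I (I.prod 𝓘(ℝ, V)) ∞ (fun x => (⟨x, t x⟩ : TotalSpace V F)) W ↔
      ∀ i, ContMDiffOn I 𝓘(ℝ, ℝ) ∞ (fun x => frameCoeff V F x₀ i x (t x)) W := by
  refine ⟨fun h i => contMDiffOn_frameCoeff_of_map
    (f := fun x => (⟨x, t x⟩ : TotalSpace V F)) h (fun x hx => hW hx) i, fun h => ?_⟩
  rw [(trivializationAt V F x₀).contMDiffOn_iff
    (fun x hx => ((trivializationAt V F x₀).mem_source).2 (hW hx))]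
  refine ⟨contMDiffOn_id, ?_⟩
  let L : V ≃L[ℝ] (Fin (Module.finrank ℝ V) → ℝ) :=
    (Module.finBasis ℝ V).equivFun.toContinuousLinearEquiv
  have h2 := L.symm.toContinuousLinearMap.contMDiff.comp_contMDiffOn (contMDiffOn_pi_space.2 h)
  refine h2.congr fun x hx => ?_
  refine L.injective ?_
  change L _ = L (L.symm _)
  rw [L.apply_symm_apply]
  exact (funext fun i => frameCoeff_apply (hW hx) i (t x)).symm

variable (I V F)

/-- Global smooth sections of `F` which, on a neighbourhood `dom` of `x₀`, are the frame that
corresponds to the standard basis of `V` under the preferred trivialization at `x₀`. -/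
structure LocalFrame (x₀ : M) where
  /-- the neighbourhood on which the sections form a frame -/
  dom : Set M
  isOpen_dom : IsOpen dom
  mem_dom : x₀ ∈ dom
  dom_subset : dom ⊆ (trivializationAt V F x₀).baseSet
  /-- the sections -/
  sec : Fin (Module.finrank ℝ V) → Cₛ^∞⟮I; V, F⟯
  coeff_sec : ∀ x ∈ dom, ∀ i j, frameCoeff V F x₀ i x (sec j x) = if i = j then 1 else 0

theorem nonempty_localFrame [FiniteDimensional ℝ E] [IsManifold I ∞ M] [T2Space M]
    [ContMDiffVectorBundle ∞ V F I] (x₀ : M) : Nonempty (LocalFrame I V F x₀) := by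
  let e := trivializationAt V F x₀
  let b := Module.finBasis ℝ V
  have hb := fun i => exists_contMDiffSection_eventuallyEq e.open_baseSet
    (mem_baseSet_trivializationAt V F x₀) (e.contMDiffOn_localFrame_baseSet (I := I) ∞ b i)
  choose s hs using hb
  obtain ⟨W, hW, hWo, hWx⟩ := eventually_nhds_iff.1 (Filter.eventually_all.2 hs)
  refine ⟨⟨W ∩ e.baseSet, hWo.inter e.open_baseSet,
    ⟨hWx, mem_baseSet_trivializationAt V F x₀⟩, Set.inter_subset_right, s, ?_⟩⟩
  intro x hx i j
  rw [frameCoeff_apply hx.2, hW x hx.1 j, e.localFrame_apply_of_mem_baseSet b hx.2]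
  simp [Trivialization.basisAt, e, b, hx.2, Finsupp.single_apply, eq_comm]

variable {I V F}

namespace LocalFrame

variable {x₀ : M} (fr : LocalFrame I V F x₀)

theorem sum_coeff_smul {x : M} (hx : x ∈ fr.dom) (w : F x) :
    ∑ i, frameCoeff V F x₀ i x w • fr.sec i x = w := by
  refine frameCoeff_ext (fr.dom_subset hx) fun j => ?_
  simp [map_sum, fr.coeff_sec x hx]

theorem contMDiffOn_coeff [ContMDiffVectorBundle ∞ V F I] (t : Cₛ^∞⟮I; V, F⟯)
    (i : Fin (Module.finrank ℝ V)) :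
    ContMDiffOn I 𝓘(ℝ, ℝ) ∞ (fun x => frameCoeff V F x₀ i x (t x)) fr.dom :=
  (contMDiffOn_section_iff_frameCoeff fr.dom_subset t).1 t.contMDiff.contMDiffOn i

theorem mdifferentiableAt_coeff [ContMDiffVectorBundle ∞ V F I] (t : Cₛ^∞⟮I; V, F⟯)
    (i : Fin (Module.finrank ℝ V)) {x : M} (hx : x ∈ fr.dom) :
    MDifferentiableAt I 𝓘(ℝ, ℝ) (fun x => frameCoeff V F x₀ i x (t x)) x :=
  ((fr.contMDiffOn_coeff t i).contMDiffAt (fr.isOpen_dom.mem_nhds hx)).mdifferentiableAt (by simp)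

end LocalFrame

end Frames

/-! ### Derivations in a local frame -/

section DerivationFrames

variable {E : Type*} [NormedAddCommGroup E] [NormedSpace ℝ E] {H : Type*}
  [TopologicalSpace H] {I : ModelWithCorners ℝ E H} {M : Type*} [TopologicalSpace M]
  [ChartedSpace H M]
  {V : Type*} [NormedAddCommGroup V] [NormedSpace ℝ V]
  {F : M → Type*} [TopologicalSpace (TotalSpace V F)] [∀ x, AddCommGroup (F x)]
  [∀ x, Module ℝ (F x)] [∀ x, TopologicalSpace (F x)] [FiberBundle V F] [VectorBundle ℝ V F]

theorem mvfderiv_eq_of_eventuallyEq {f g : M → ℝ} {x : M} (h : f =ᶠ[𝓝 x] g)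
    (v : TangentSpace I x) : mvfderiv I f x v = mvfderiv I g x v := by
  have h2 : mfderiv I 𝓘(ℝ, ℝ) f x v = mfderiv I 𝓘(ℝ, ℝ) g x v := by
    rw [h.mfderiv_eq]
    rfl
  exact h2

@[simp]
theorem smulSection_apply (f : C^∞⟮I, M; ℝ⟯) (s : Cₛ^∞⟮I; V, F⟯) (x : M) :
    smulSection I V F f s x = f x • s x := rfl

/-- A derivation applied to a finite combination of sections. -/
theorem derivation_sum_smulSection {x : M} (d : DerivationFibre I V F x) {k : ℕ}
    (f : Fin k → C^∞⟮I, M; ℝ⟯) (s : Fin k → Cₛ^∞⟮I; V, F⟯) :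
    d.1.1 (∑ i, smulSection I V F (f i) (s i)) =
      ∑ i, (f i x • d.1.1 (s i) + mvfderiv I (f i) x d.1.2 • s i x) := by
  rw [map_sum]
  exact Finset.sum_congr rfl fun i _ => d.2 (f i) (s i)

theorem sum_smulSection_apply {k : ℕ} (f : Fin k → C^∞⟮I, M; ℝ⟯) (s : Fin k → Cₛ^∞⟮I; V, F⟯)
    (x : M) : (∑ i, smulSection I V F (f i) (s i)) x = ∑ i, f i x • s i x := by
  have h := map_sum (ContMDiffSection.coeAddHom I V ∞ F)
    (fun i => smulSection I V F (f i) (s i)) Finset.univ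
  have h2 := congrFun h x
  rw [Finset.sum_apply] at h2
  exact h2

variable [FiniteDimensional ℝ E] [IsManifold I ∞ M] [T2Space M]

/-- Derivations are local operators: apply the derivation to the equal products of `s` and `t` with
a bump function supported where they agree. -/
theorem derivation_congr {x : M} (d : DerivationFibre I V F x) {s t : Cₛ^∞⟮I; V, F⟯}
    (h : ∀ᶠ y in 𝓝 x, s y = t y) : d.1.1 s = d.1.1 t := by
  obtain ⟨U, hU, hUo, hxU⟩ := eventually_nhds_iff.1 h
  obtain ⟨f, h1, hf⟩ := exists_smooth_eventuallyEq_one (I := I) hUo hxU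
  have hfst : smulSection I V F f s = smulSection I V F f t := by
    ext y
    by_cases hy : y ∈ U
    · simp [hU y hy]
    · have : f y = 0 := image_eq_zero_of_notMem_tsupport fun h' => hy (hf h')
      simp [this]
  have hs := d.2 f s
  have ht := d.2 f t
  rw [hfst, ht, hU x hxU, h1.self_of_nhds, one_smul, one_smul] at hs
  exact (add_right_cancel hs).symm

variable [FiniteDimensional ℝ V] [ContMDiffVectorBundle ∞ V F I]

section

variable {x₀ : M} (fr : LocalFrame I V F x₀) {x : M}

/-- A derivation is determined by its values on a frame and by its symbol. -/
theorem derivation_apply_eq_sum (hx : x ∈ fr.dom) (d : DerivationFibre I V F x)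
    (t : Cₛ^∞⟮I; V, F⟯) :
    d.1.1 t = ∑ i, (frameCoeff V F x₀ i x (t x) • d.1.1 (fr.sec i) +
      mvfderiv I (fun y => frameCoeff V F x₀ i y (t y)) x d.1.2 • fr.sec i x) := by
  have hg := fun i => exists_contMDiffMap_eventuallyEq fr.isOpen_dom hx (fr.contMDiffOn_coeff t i)
  choose g hg using hg
  have ht : ∀ᶠ y in 𝓝 x, t y = (∑ i, smulSection I V F (g i) (fr.sec i)) y := by
    filter_upwards [Filter.eventually_all.2 hg, fr.isOpen_dom.mem_nhds hx] with y hy hyd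
    rw [sum_smulSection_apply]
    simp only [hy]
    exact (fr.sum_coeff_smul hyd (t y)).symm
  rw [derivation_congr d ht, derivation_sum_smulSection]
  refine Finset.sum_congr rfl fun i _ => ?_
  rw [(hg i).eq_of_nhds, mvfderiv_eq_of_eventuallyEq (hg i)]

theorem derivation_ext (hx : x ∈ fr.dom) {d d' : DerivationFibre I V F x}
    (h : ∀ i, d.1.1 (fr.sec i) = d'.1.1 (fr.sec i)) (hv : d.1.2 = d'.1.2) : d = d' := by
  refine Subtype.ext (Prod.ext (LinearMap.ext fun t => ?_) hv)
  rw [derivation_apply_eq_sum fr hx, derivation_apply_eq_sum fr hx, hv]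
  simp only [h]

/-- Over the domain of a frame, the values of a derivation on the frame and its symbol can be
prescribed: the formula of `derivation_apply_eq_sum` defines a derivation. -/
theorem exists_derivation (hx : x ∈ fr.dom) (w : Fin (Module.finrank ℝ V) → F x)
    (v : TangentSpace I x) :
    ∃ d : DerivationFibre I V F x, (∀ i, d.1.1 (fr.sec i) = w i) ∧ d.1.2 = v := by
  have hm := fun (t : Cₛ^∞⟮I; V, F⟯) i => fr.mdifferentiableAt_coeff t i hx
  let δ : Cₛ^∞⟮I; V, F⟯ →ₗ[ℝ] F x :=
    { toFun := fun t => ∑ i, (frameCoeff V F x₀ i x (t x) • w i +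
        mvfderiv I (fun y => frameCoeff V F x₀ i y (t y)) x v • fr.sec i x)
      map_add' := by
        intro s t
        rw [← Finset.sum_add_distrib]
        refine Finset.sum_congr rfl fun i _ => ?_
        have e : (fun y => frameCoeff V F x₀ i y ((s + t) y)) =
            (fun y => frameCoeff V F x₀ i y (s y)) + (fun y => frameCoeff V F x₀ i y (t y)) := by
          funext y
          simp
        rw [e, mvfderiv_add (hm s i) (hm t i)]
        simp only [ContMDiffSection.coe_add, Pi.add_apply, map_add, add_apply,
          add_smul]
        abel
      map_smul' := by
        intro c t
        rw [RingHom.id_apply, Finset.smul_sum]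
        refine Finset.sum_congr rfl fun i _ => ?_
        have e : (fun y => frameCoeff V F x₀ i y ((c • t) y)) =
            (fun _ : M => c) * (fun y => frameCoeff V F x₀ i y (t y)) := by
          funext y
          simp
        rw [e, mvfderiv_mul mdifferentiableAt_const (hm t i)]
        simp [mvfderiv_const, mul_smul] }
  have hδ : ∀ t, δ t = ∑ i, (frameCoeff V F x₀ i x (t x) • w i +
        mvfderiv I (fun y => frameCoeff V F x₀ i y (t y)) x v • fr.sec i x) := fun t => rfl
  refine ⟨⟨(δ, v), ?_⟩, ?_, rfl⟩
  · intro f t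
    have hw := fr.sum_coeff_smul hx (t x)
    change δ _ = f x • δ t + mvfderiv I f x v • t x
    rw [hδ, hδ, ← hw, Finset.smul_sum, Finset.smul_sum, ← Finset.sum_add_distrib]
    refine Finset.sum_congr rfl fun i _ => ?_
    have e : (fun y => frameCoeff V F x₀ i y (smulSection I V F f t y)) =
        ⇑f * (fun y => frameCoeff V F x₀ i y (t y)) := by
      funext y
      simp
    rw [e, mvfderiv_mul (f.contMDiff.mdifferentiableAt (by simp)) (hm t i), hw]
    simp only [smulSection_apply, map_smul, smul_eq_mul, add_apply,
      smul_apply, add_smul, mul_smul, smul_add]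
    rw [smul_comm (frameCoeff V F x₀ i x (t x)) (mvfderiv I f x v)]
    abel
  · intro j
    change δ _ = _
    rw [hδ]
    -- the coefficients of the sections of the frame are locally constant
    have e : ∀ i, mvfderiv I (fun y => frameCoeff V F x₀ i y (fr.sec j y)) x v = 0 := by
      intro i
      have e1 : (fun y => frameCoeff V F x₀ i y (fr.sec j y)) =ᶠ[𝓝 x]
          fun _ => if i = j then (1 : ℝ) else 0 := by
        filter_upwards [fr.isOpen_dom.mem_nhds hx] with y hy
        exact fr.coeff_sec y hy i j
      rw [mvfderiv_eq_of_eventuallyEq e1, mvfderiv_const]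
      rfl
    simp [e, fr.coeff_sec x hx]

end

theorem contMDiffOn_mvfderiv_apply {W : Set M} (hW : IsOpen W) {g : M → ℝ}
    (hg : ContMDiffOn I 𝓘(ℝ, ℝ) ∞ g W) {X : ∀ x : M, TangentSpace I x} (hX : SmoothFieldOn X W) :
    ContMDiffOn I 𝓘(ℝ, ℝ) ∞ (fun y => mvfderiv I g y (X y)) W := by
  intro x hx
  obtain ⟨f, hf⟩ := exists_contMDiffMap_eventuallyEq hW hx hg
  have h := contMDiffAt_mvfderiv_apply (hX.contMDiffAt (hW.mem_nhds hx)) f.contMDiff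
  refine (h.congr_of_eventuallyEq ?_).contMDiffWithinAt
  filter_upwards [eventually_eventually_nhds.2 hf] with y hy
  exact (mvfderiv_eq_of_eventuallyEq hy _).symm

/-! ### The bundle of derivations -/

/-- The index type of the coordinates on the bundle of derivations: matrix entries and the
components of the symbol. -/
abbrev DerivationIndex (E V : Type*) [NormedAddCommGroup E] [NormedSpace ℝ E]
    [NormedAddCommGroup V] [NormedSpace ℝ V] : Type :=
  (Fin (Module.finrank ℝ V) × Fin (Module.finrank ℝ V)) ⊕ Fin (Module.finrank ℝ E)

/-- The coordinates of a derivation with respect to a local frame of `F` and the coordinate frame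
of the tangent bundle. -/
def derivationCoords {x₀ : M} (fr : LocalFrame I V F x₀) (x : M) :
    DerivationFibre I V F x →ₗ[ℝ] (DerivationIndex E V → ℝ) :=
  LinearMap.pi fun
    | .inl (i, j) => frameCoeff V F x₀ i x ∘ₗ LinearMap.applyₗ (fr.sec j) ∘ₗ
        LinearMap.fst ℝ _ _ ∘ₗ (DerivationFibre I V F x).subtype
    | .inr k => frameCoeff E (TangentSpace I : M → Type _) x₀ k x ∘ₗ LinearMap.snd ℝ _ _ ∘ₗ
        (DerivationFibre I V F x).subtype

/-- The open set on which `derivationCoords` are coordinates. -/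
def derivationDom {x₀ : M} (fr : LocalFrame I V F x₀) : Set M :=
  fr.dom ∩ (trivializationAt E (TangentSpace I : M → Type _) x₀).baseSet

theorem isOpen_derivationDom {x₀ : M} (fr : LocalFrame I V F x₀) : IsOpen (derivationDom fr) :=
  fr.isOpen_dom.inter (Trivialization.open_baseSet _)

theorem mem_derivationDom {x₀ : M} (fr : LocalFrame I V F x₀) : x₀ ∈ derivationDom fr :=
  ⟨fr.mem_dom, mem_baseSet_trivializationAt E (TangentSpace I : M → Type _) x₀⟩

theorem bijective_derivationCoords {x₀ : M} (fr : LocalFrame I V F x₀) {x : M}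
    (hx : x ∈ derivationDom fr) : Function.Bijective (derivationCoords fr x) := by
  constructor
  · intro d d' h
    refine derivation_ext fr hx.1 (fun j => ?_) ?_
    · exact frameCoeff_ext (fr.dom_subset hx.1) fun i => congrFun h (.inl (i, j))
    · exact frameCoeff_ext (F := (TangentSpace I : M → Type _)) hx.2 fun k => congrFun h (.inr k)
  · intro c
    choose w hw using fun j => (bijective_frameCoeff (fr.dom_subset hx.1)).2
      (fun i => c (.inl (i, j)))
    obtain ⟨v, hv⟩ := (bijective_frameCoeff (F := (TangentSpace I : M → Type _)) hx.2).2
      (fun k => c (.inr k))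
    obtain ⟨d, hd, hdv⟩ := exists_derivation fr hx.1 w v
    refine ⟨d, funext ?_⟩
    rintro (⟨i, j⟩ | k)
    · change frameCoeff V F x₀ i x (d.1.1 (fr.sec j)) = _
      rw [hd]
      exact congrFun (hw j) i
    · change frameCoeff E (TangentSpace I : M → Type _) x₀ k x d.1.2 = _
      rw [hdv]
      exact congrFun hv k

/-- Over the domain of a frame, smoothness of a family of derivations can be tested on the frame and
on the symbol. -/
theorem derivationSmoothOn_of_frame {x₀ : M} (fr : LocalFrame I V F x₀) {W : Set M}
    (hW : IsOpen W) (hWd : W ⊆ fr.dom) {d : ∀ x, DerivationFibre I V F x}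
    (h1 : ∀ j, ContMDiffOn I (I.prod 𝓘(ℝ, V)) ∞
        (fun x => (⟨x, (d x).1.1 (fr.sec j)⟩ : TotalSpace V F)) W)
    (h2 : SmoothFieldOn (fun x => (d x).1.2) W) : DerivationSmoothOn W d := by
  refine ⟨fun t => ?_, h2⟩
  have hc : ∀ i, ContMDiffOn I 𝓘(ℝ, ℝ) ∞ (fun x => frameCoeff V F x₀ i x (t x)) W :=
    fun i => (fr.contMDiffOn_coeff t i).mono hWd
  have hs : ContMDiffOn I (I.prod 𝓘(ℝ, V)) ∞ (fun x => (⟨x, ∑ i,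
      (frameCoeff V F x₀ i x (t x) • (d x).1.1 (fr.sec i) +
      mvfderiv I (fun y => frameCoeff V F x₀ i y (t y)) x (d x).1.2 • fr.sec i x)⟩ :
        TotalSpace V F)) W := by
    refine ContMDiffOn.sum_section (t := fun i x =>
      (frameCoeff V F x₀ i x (t x) • (d x).1.1 (fr.sec i) +
      mvfderiv I (fun y => frameCoeff V F x₀ i y (t y)) x (d x).1.2 • fr.sec i x))
      fun i _ => ?_
    exact ((hc i).smul_section (h1 i)).add_section
      ((contMDiffOn_mvfderiv_apply hW (hc i) h2).smul_section (fr.sec i).contMDiff.contMDiffOn)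
  refine hs.congr fun x hx => ?_
  rw [derivation_apply_eq_sum fr (hWd hx)]

instance contMDiffVectorBundle_tangentSpace :
    ContMDiffVectorBundle ∞ E (TangentSpace I : M → Type _) I := by
  have i5 : IsManifold I (((⊤ : ℕ∞) : WithTop ℕ∞) + 1) M := by simpa using! ‹IsManifold I ∞ M›
  exact TangentBundle.contMDiffVectorBundle

/-- `derivationCoords` are compatible with the smoothness of families of derivations. -/
theorem derivationSmoothOn_iff_coords {x₀ : M} (fr : LocalFrame I V F x₀) {W : Set M}
    (hW : IsOpen W) (hWd : W ⊆ derivationDom fr) (d : ∀ x, DerivationFibre I V F x) :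
    DerivationSmoothOn W d ↔
      ∀ i, ContMDiffOn I 𝓘(ℝ, ℝ) ∞ (fun x => derivationCoords fr x (d x) i) W := by
  have hT := contMDiffOn_section_iff_frameCoeff (I := I) (F := (TangentSpace I : M → Type _))
    (fun x hx => (hWd hx).2) (fun x => (d x).1.2)
  have hF := fun t : Cₛ^∞⟮I; V, F⟯ => contMDiffOn_section_iff_frameCoeff (I := I)
    (fun x hx => fr.dom_subset (hWd hx).1) (fun x => (d x).1.1 t)
  constructor
  · rintro ⟨h1, h2⟩ (⟨i, j⟩ | k)
    · exact (hF (fr.sec j)).1 (h1 _) i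
    · exact hT.1 h2 k
  · intro h
    exact derivationSmoothOn_of_frame fr hW (fun x hx => (hWd hx).1)
      (fun j => (hF (fr.sec j)).2 fun i => h (.inl (i, j))) (hT.2 fun k => h (.inr k))

end DerivationFrames

/-! ### Derivations form a Lie algebroid -/

section DerivationLie

variable {E : Type*} [NormedAddCommGroup E] [NormedSpace ℝ E] {H : Type*}
  [TopologicalSpace H] {I : ModelWithCorners ℝ E H} {M : Type*} [TopologicalSpace M]
  [ChartedSpace H M]
  {V : Type*} [NormedAddCommGroup V] [NormedSpace ℝ V]
  {F : M → Type*} [TopologicalSpace (TotalSpace V F)] [∀ x, AddCommGroup (F x)]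
  [∀ x, Module ℝ (F x)] [∀ x, TopologicalSpace (F x)] [FiberBundle V F] [VectorBundle ℝ V F]
  [IsManifold I ∞ M]

theorem DerivationSmoothOn.add {U : Set M} {d₁ d₂ : ∀ x, DerivationFibre I V F x}
    (h₁ : DerivationSmoothOn U d₁) (h₂ : DerivationSmoothOn U d₂) :
    DerivationSmoothOn U (d₁ + d₂) :=
  ⟨fun s => (h₁.1 s).add_section (h₂.1 s), ContMDiffOn.add_section h₁.2 h₂.2⟩

theorem DerivationSmoothOn.smul {U : Set M} {d : ∀ x, DerivationFibre I V F x} {f : M → ℝ}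
    (hf : ContMDiffOn I 𝓘(ℝ, ℝ) ∞ f U) (h : DerivationSmoothOn U d) :
    DerivationSmoothOn U (fun x => f x • d x) :=
  ⟨fun s => hf.smul_section (h.1 s), ContMDiffOn.smul_section hf h.2⟩

@[simp]
theorem derivationOperator_apply {d : ∀ x, DerivationFibre I V F x}
    (hd : DerivationSmoothOn Set.univ d) (s : Cₛ^∞⟮I; V, F⟯) (x : M) :
    derivationOperator d hd s x = (d x).1.1 s := rfl

theorem derivationAlgebroid_isLocal [CompleteSpace E] :
    (derivationAlgebroid I V F).IsLocal where
  mono _ _ _ _ h _ hs := ⟨fun t => (hs.1 t).mono h, hs.2.mono h⟩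
  glue W hW s h := by
    constructor
    · intro t x hx
      obtain ⟨W', hW', hx', hs⟩ := h x hx
      exact ((hs.1 t).contMDiffAt (hW'.mem_nhds hx')).contMDiffWithinAt
    · intro x hx
      obtain ⟨W', hW', hx', hs⟩ := h x hx
      exact (hs.2.contMDiffAt (hW'.mem_nhds hx')).contMDiffWithinAt

variable [CompleteSpace E]

theorem derivationAlgebroid_bracket {d₁ d₂ : ∀ x, DerivationFibre I V F x}
    (h₁ : DerivationSmoothOn Set.univ d₁) (h₂ : DerivationSmoothOn Set.univ d₂) :
    (derivationAlgebroid I V F).bracket d₁ d₂ = derivationCommutator d₁ d₂ h₁ h₂ :=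
  dif_pos (⟨h₁, h₂⟩ : _ ∧ _)

theorem derivationCommutator_fst {d₁ d₂ : ∀ x, DerivationFibre I V F x}
    (h₁ : DerivationSmoothOn Set.univ d₁) (h₂ : DerivationSmoothOn Set.univ d₂) (x : M)
    (s : Cₛ^∞⟮I; V, F⟯) : (derivationCommutator d₁ d₂ h₁ h₂ x).1.1 s =
      (d₁ x).1.1 (derivationOperator d₂ h₂ s) - (d₂ x).1.1 (derivationOperator d₁ h₁ s) := rfl

theorem derivationCommutator_snd {d₁ d₂ : ∀ x, DerivationFibre I V F x}
    (h₁ : DerivationSmoothOn Set.univ d₁) (h₂ : DerivationSmoothOn Set.univ d₂) (x : M) :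
    (derivationCommutator d₁ d₂ h₁ h₂ x).1.2 =
      mlieBracket I (fun y => (d₁ y).1.2) (fun y => (d₂ y).1.2) x := rfl

theorem derivationSmoothOn_commutator {d₁ d₂ : ∀ x, DerivationFibre I V F x}
    (h₁ : DerivationSmoothOn Set.univ d₁) (h₂ : DerivationSmoothOn Set.univ d₂) :
    DerivationSmoothOn Set.univ (derivationCommutator d₁ d₂ h₁ h₂) := by
  have i4 : IsManifold I (minSmoothness ℝ 3) M := by
    simpa using (IsManifold.of_le (n := ∞) (by norm_cast) : IsManifold I 3 M)
  have i5 : IsManifold I (((⊤ : ℕ∞) : WithTop ℕ∞) + 1) M := by simpa using! ‹IsManifold I ∞ M›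
  constructor
  · intro s
    exact (h₁.1 (derivationOperator d₂ h₂ s)).sub_section (h₂.1 (derivationOperator d₁ h₁ s))
  · intro x _
    exact ((contMDiffOn_univ.1 h₁.2 x).mlieBracket_vectorField (contMDiffOn_univ.1 h₂.2 x)
      (by simp)).contMDiffWithinAt

variable [FiniteDimensional ℝ E] [T2Space M] [FiniteDimensional ℝ V] [ContMDiffVectorBundle ∞ V F I]

theorem derivationAlgebroid_isSmoothVectorBundle :
    (derivationAlgebroid I V F).IsSmoothVectorBundle := by
  let fr : ∀ x₀ : M, LocalFrame I V F x₀ := fun x₀ => (nonempty_localFrame I V F x₀).some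
  exact AlgebroidData.isSmoothVectorBundle_of_coordinates _ derivationAlgebroid_isLocal
    (fun x₀ => derivationDom (fr x₀)) (fun x₀ => isOpen_derivationDom _)
    (fun x₀ => mem_derivationDom _) (fun x₀ => derivationCoords (fr x₀))
    (fun x₀ x hx => bijective_derivationCoords (fr x₀) hx)
    (fun x₀ W hW hWU s => derivationSmoothOn_iff_coords (fr x₀) hW hWU s)

/-! #### Identities for the commutator of derivations -/

section Identities

variable {r s t : ∀ x, DerivationFibre I V F x} (hr : DerivationSmoothOn Set.univ r)
  (hs : DerivationSmoothOn Set.univ s) (ht : DerivationSmoothOn Set.univ t)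

theorem DerivationSmoothOn.contMDiffAt_symbol {x : M} (hs : DerivationSmoothOn Set.univ s) :
    ContMDiffAt I I.tangent ∞ (fun x => (⟨x, (s x).1.2⟩ : TangentBundle I M)) x :=
  contMDiffOn_univ.1 hs.2 x

theorem DerivationSmoothOn.mdifferentiableAt_symbol {x : M} (hs : DerivationSmoothOn Set.univ s) :
    MDifferentiableAt I I.tangent (fun x => (⟨x, (s x).1.2⟩ : TangentBundle I M)) x :=
  hs.contMDiffAt_symbol.mdifferentiableAt (by simp)

theorem derivationCommutator_add : derivationCommutator r (s + t) hr (hs.add ht) =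
    derivationCommutator r s hr hs + derivationCommutator r t hr ht := by
  have i2 : IsManifold I 2 M := IsManifold.of_le (n := ∞) (by norm_cast)
  funext x
  refine Subtype.ext (Prod.ext (LinearMap.ext fun σ => ?_) ?_)
  · have e : derivationOperator (s + t) (hs.add ht) σ =
        derivationOperator s hs σ + derivationOperator t ht σ := by
      ext y
      rfl
    change _ = (derivationCommutator r s hr hs x).1.1 σ + (derivationCommutator r t hr ht x).1.1 σ
    rw [derivationCommutator_fst, derivationCommutator_fst, derivationCommutator_fst, e, map_add]
    change _ - ((s x).1.1 _ + (t x).1.1 _) = _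
    abel
  · exact mlieBracket_add_right hs.mdifferentiableAt_symbol ht.mdifferentiableAt_symbol

theorem derivationCommutator_smul (f : C^∞⟮I, M; ℝ⟯) (x : M) :
    derivationCommutator s (fun y => f y • t y) hs (ht.smul f.contMDiff.contMDiffOn) x =
      f x • derivationCommutator s t hs ht x + mvfderiv I f x (s x).1.2 • t x := by
  have i2 : IsManifold I 2 M := IsManifold.of_le (n := ∞) (by norm_cast)
  refine Subtype.ext (Prod.ext (LinearMap.ext fun σ => ?_) ?_)
  · have e : derivationOperator _ (ht.smul f.contMDiff.contMDiffOn) σ =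
        smulSection I V F f (derivationOperator t ht σ) := by
      ext y
      rfl
    change _ = f x • (derivationCommutator s t hs ht x).1.1 σ +
      mvfderiv I f x (s x).1.2 • (t x).1.1 σ
    rw [derivationCommutator_fst, derivationCommutator_fst, e, (s x).2, smul_sub]
    change _ - f x • (t x).1.1 _ = _
    rw [derivationOperator_apply]
    abel
  · change mlieBracket I _ (⇑f • fun y => (t y).1.2) x = _
    rw [mlieBracket_smul_right (f.contMDiff.mdifferentiableAt (by simp))
      ht.mdifferentiableAt_symbol, add_comm]
    rfl

theorem derivationCommutator_const_smul (c : ℝ) :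
    derivationCommutator s (c • t) hs (ht.smul contMDiffOn_const) =
      c • derivationCommutator s t hs ht := by
  funext x
  let f : C^∞⟮I, M; ℝ⟯ := ⟨fun _ => c, contMDiff_const⟩
  have h0 : mvfderiv I f x = 0 := mvfderiv_const c
  refine (derivationCommutator_smul hs ht f x).trans ?_
  rw [h0, zero_apply, zero_smul, add_zero]
  rfl

theorem derivationCommutator_skew :
    derivationCommutator s t hs ht = -derivationCommutator t s ht hs := by
  funext x
  refine Subtype.ext (Prod.ext (LinearMap.ext fun σ => ?_) ?_)
  · change _ = -(derivationCommutator t s ht hs x).1.1 σ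
    rw [derivationCommutator_fst, derivationCommutator_fst, neg_sub]
  · exact mlieBracket_swap_apply

theorem derivationOperator_commutator (σ : Cₛ^∞⟮I; V, F⟯) :
    derivationOperator _ (derivationSmoothOn_commutator hs ht) σ =
      derivationOperator s hs (derivationOperator t ht σ) -
        derivationOperator t ht (derivationOperator s hs σ) := by
  ext y
  rfl

theorem derivationCommutator_jacobi :
    derivationCommutator r _ hr (derivationSmoothOn_commutator hs ht) +
      derivationCommutator s _ hs (derivationSmoothOn_commutator ht hr) +
      derivationCommutator t _ ht (derivationSmoothOn_commutator hr hs) = 0 := by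
  have i2 : IsManifold I 2 M := IsManifold.of_le (n := ∞) (by norm_cast)
  have i4 : IsManifold I (minSmoothness ℝ 3) M := by
    simpa using (IsManifold.of_le (n := ∞) (by norm_cast) : IsManifold I 3 M)
  have two : (minSmoothness ℝ 2) ≤ (∞ : WithTop ℕ∞) := by simp; norm_cast
  funext x
  refine Subtype.ext (Prod.ext (LinearMap.ext fun σ => ?_) ?_)
  · change (derivationCommutator r _ hr _ x).1.1 σ + (derivationCommutator s _ hs _ x).1.1 σ +
      (derivationCommutator t _ ht _ x).1.1 σ = 0
    simp only [derivationCommutator_fst, derivationOperator_commutator, map_sub]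
    abel
  · have j := leibniz_identity_mlieBracket_apply (I := I)
      ((hr.contMDiffAt_symbol (x := x)).of_le two) ((hs.contMDiffAt_symbol (x := x)).of_le two)
      ((ht.contMDiffAt_symbol (x := x)).of_le two)
    change mlieBracket I (fun y => (r y).1.2)
        (mlieBracket I (fun y => (s y).1.2) (fun y => (t y).1.2)) x +
      mlieBracket I (fun y => (s y).1.2)
        (mlieBracket I (fun y => (t y).1.2) (fun y => (r y).1.2)) x +
      mlieBracket I (fun y => (t y).1.2)
        (mlieBracket I (fun y => (r y).1.2) (fun y => (s y).1.2)) x = 0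
    -- Mathlib's Jacobi identity is in Leibniz form, with the double brackets in another order
    have e1 : mlieBracket I (fun y => (s y).1.2)
        (mlieBracket I (fun y => (t y).1.2) (fun y => (r y).1.2)) x =
        -mlieBracket I (fun y => (s y).1.2)
        (mlieBracket I (fun y => (r y).1.2) (fun y => (t y).1.2)) x := by
      rw [mlieBracket_swap (V := fun y => (t y).1.2)]
      have i5 : IsManifold I (((⊤ : ℕ∞) : WithTop ℕ∞) + 1) M := by
        simpa using! ‹IsManifold I ∞ M›
      have hd : MDifferentiableAt I I.tangent (fun y => (⟨y, mlieBracket I (fun y => (r y).1.2)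
          (fun y => (t y).1.2) y⟩ : TangentBundle I M)) x :=
        (derivationSmoothOn_commutator hr ht).mdifferentiableAt_symbol
      have := mlieBracket_const_smul_right (I := I) (c := (-1 : ℝ)) (V := fun y => (s y).1.2) hd
      simpa using this
    rw [e1, mlieBracket_swap_apply (V := fun y => (t y).1.2), j]
    abel

end Identities

theorem derivationAlgebroid_isLieAlgebroid : (derivationAlgebroid I V F).IsLieAlgebroid where
  isSmoothVectorBundle := derivationAlgebroid_isSmoothVectorBundle
  anchor_smooth _ _ _ hs := hs.2
  bracket_smooth s t hs ht := by
    rw [derivationAlgebroid_bracket hs ht]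
    exact derivationSmoothOn_commutator hs ht
  bracket_add r s t hr hs ht :=
    (derivationAlgebroid_bracket hr (hs.add ht)).trans ((derivationCommutator_add hr hs ht).trans
      (congrArg₂ _ (derivationAlgebroid_bracket hr hs) (derivationAlgebroid_bracket hr ht)).symm)
  bracket_smul c s t hs ht :=
    (derivationAlgebroid_bracket hs (ht.smul contMDiffOn_const)).trans
      ((derivationCommutator_const_smul hs ht c).trans
        (congrArg (fun d => c • d) (derivationAlgebroid_bracket hs ht)).symm)
  bracket_skew s t hs ht := (derivationAlgebroid_bracket hs ht).trans
    ((derivationCommutator_skew hs ht).trans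
      (congrArg (fun d => -d) (derivationAlgebroid_bracket ht hs)).symm)
  jacobi r s t hr hs ht := by
    have e {a b c : ∀ x, DerivationFibre I V F x} (ha : DerivationSmoothOn Set.univ a)
        (hb : DerivationSmoothOn Set.univ b) (hc : DerivationSmoothOn Set.univ c) :
        (derivationAlgebroid I V F).bracket a ((derivationAlgebroid I V F).bracket b c) =
          derivationCommutator a _ ha (derivationSmoothOn_commutator hb hc) := by
      rw [derivationAlgebroid_bracket hb hc]
      exact derivationAlgebroid_bracket ha (derivationSmoothOn_commutator hb hc)
    refine Eq.trans ?_ (derivationCommutator_jacobi hr hs ht)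
    exact congrArg₂ _ (congrArg₂ _ (e hr hs ht) (e hs ht hr)) (e ht hr hs)
  leibniz s t f hs ht x := by
    have e1 := derivationAlgebroid_bracket hs (ht.smul f.contMDiff.contMDiffOn)
    refine (congrFun e1 x).trans ((derivationCommutator_smul hs ht f x).trans ?_)
    exact congrArg (fun d : DerivationFibre I V F x => f x • d +
        mvfderiv I f x (s x).1.2 • (show DerivationFibre I V F x from t x))
      (congrFun (derivationAlgebroid_bracket hs ht) x).symm
  anchor_bracket s t hs ht x := by
    rw [derivationAlgebroid_bracket hs ht]
    rfl

end DerivationLie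

/-! ### Derivations of the pull-back bundle -/

section PullbackDerivations

variable {E : Type*} [NormedAddCommGroup E] [NormedSpace ℝ E] {H : Type*}
  [TopologicalSpace H] {I : ModelWithCorners ℝ E H} {M : Type*} [TopologicalSpace M]
  [ChartedSpace H M] [IsManifold I ∞ M]
  {E' : Type*} [NormedAddCommGroup E'] [NormedSpace ℝ E'] {H' : Type*}
  [TopologicalSpace H'] {J : ModelWithCorners ℝ E' H'} {N : Type*} [TopologicalSpace N]
  [ChartedSpace H' N] [IsManifold J ∞ N]
  {V : Type*} [NormedAddCommGroup V] [NormedSpace ℝ V] [FiniteDimensional ℝ V]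
  {F : N → Type*} [TopologicalSpace (TotalSpace V F)] [∀ x, AddCommGroup (F x)]
  [∀ x, Module ℝ (F x)] [∀ x, TopologicalSpace (F x)] [FiberBundle V F] [VectorBundle ℝ V F]
  [ContMDiffVectorBundle ∞ V F J]
  (φ : C^∞⟮I, M; J, N⟯)

/-- The pull-back of sections. -/
def pullbackSection : Cₛ^∞⟮J; V, F⟯ →ₗ[ℝ] Cₛ^∞⟮I; V, φ *ᵖ F⟯ where
  toFun s := ⟨fun x => s (φ x), by
    intro x₀
    have hx₀ := mem_baseSet_trivializationAt V (φ *ᵖ F) x₀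
    have ho := (trivializationAt V (φ *ᵖ F) x₀).open_baseSet
    refine ContMDiffOn.contMDiffAt ?_ (ho.mem_nhds hx₀)
    refine (contMDiffOn_section_iff_frameCoeff subset_rfl _).2 fun i => ?_
    exact contMDiffOn_frameCoeff_of_map (x₀ := φ x₀)
      (s.contMDiff.comp φ.contMDiff).contMDiffOn (fun x hx => hx) i⟩
  map_add' s t := rfl
  map_smul' c s := rfl

variable {φ} in
/-- The pull-back of a local frame. -/
def LocalFrame.pullback {x₀ : M} (fr : LocalFrame J V F (φ x₀)) :
    LocalFrame I V (φ *ᵖ F) x₀ where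
  dom := φ ⁻¹' fr.dom
  isOpen_dom := fr.isOpen_dom.preimage φ.contMDiff.continuous
  mem_dom := fr.mem_dom
  dom_subset := fun _ hx => fr.dom_subset hx
  sec i := pullbackSection φ (fr.sec i)
  coeff_sec x hx i j := fr.coeff_sec (φ x) hx i j

theorem mvfderiv_comp_map (f : C^∞⟮J, N; ℝ⟯) (x : M) (v : TangentSpace I x) :
    mvfderiv I (f.comp φ) x v = mvfderiv J f (φ x) (mfderiv I J φ x v) :=
  mvfderiv_comp_apply x (f.contMDiff.mdifferentiableAt (by simp))
    (φ.contMDiff.mdifferentiableAt (by simp)) v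

/-- A derivation of the pull-back bundle at `m` restricts to pulled-back sections, and gives a
derivation of `F` at `φ m`. -/
def restrictDerivation (m : M) :
    DerivationFibre I V (φ *ᵖ F) m →ₗ[ℝ] DerivationFibre J V F (φ m) where
  toFun d := ⟨(d.1.1 ∘ₗ pullbackSection φ, mfderiv I J φ m d.1.2), by
    intro f s
    have h := d.2 (f.comp φ) (pullbackSection φ s)
    rw [mvfderiv_comp_map] at h
    exact h⟩
  map_add' _ _ := Subtype.ext (Prod.ext rfl (map_add _ _ _))
  map_smul' _ _ := Subtype.ext (Prod.ext rfl (map_smul _ _ _))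

variable {φ}

theorem restrictDerivation_fst {m : M} (d : DerivationFibre I V (φ *ᵖ F) m)
    (s : Cₛ^∞⟮J; V, F⟯) : (restrictDerivation φ m d).1.1 s = d.1.1 (pullbackSection φ s) := rfl

theorem restrictDerivation_snd {m : M} (d : DerivationFibre I V (φ *ᵖ F) m) :
    (restrictDerivation φ m d).1.2 = mfderiv I J φ m d.1.2 := rfl

variable [CompleteSpace E'] (φ) in
/-- The linear map from the derivations of the pull-back bundle to the fibre product of the
derivations of `F` and the tangent bundle. -/
def derivationToPullback (m : M) : DerivationFibre I V (φ *ᵖ F) m →ₗ[ℝ]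
    AlgebroidData.PullbackFibre (derivationAlgebroid J V F) φ m where
  toFun d := ⟨(restrictDerivation φ m d, d.1.2), rfl⟩
  map_add' _ _ := Subtype.ext (Prod.ext (map_add _ _ _) rfl)
  map_smul' _ _ := Subtype.ext (Prod.ext (map_smul _ _ _) rfl)

variable [FiniteDimensional ℝ E] [FiniteDimensional ℝ E'] [T2Space M] [T2Space N]
  [CompleteSpace E] [CompleteSpace E']

theorem bijective_derivationToPullback (m : M) :
    Function.Bijective (derivationToPullback (V := V) (F := F) φ m) := by
  obtain ⟨fr⟩ := nonempty_localFrame J V F (φ m)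
  constructor
  · intro d d' h
    have h1 : restrictDerivation φ m d = restrictDerivation φ m d' :=
      congrArg (fun p => p.1.1) h
    have h2 : d.1.2 = d'.1.2 := congrArg (fun p => p.1.2) h
    exact derivation_ext fr.pullback fr.pullback.mem_dom
      (fun i => congrArg (fun e : DerivationFibre J V F (φ m) => e.1.1 (fr.sec i)) h1) h2
  · rintro ⟨⟨(δ : DerivationFibre J V F (φ m)), u⟩, hδ⟩
    change δ.1.2 = mfderiv I J φ m u at hδ
    obtain ⟨d, hd, hu⟩ := exists_derivation fr.pullback fr.pullback.mem_dom
      (fun i => δ.1.1 (fr.sec i)) u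
    refine ⟨d, Subtype.ext (Prod.ext ?_ hu)⟩
    change restrictDerivation φ m d = δ
    refine derivation_ext fr fr.mem_dom hd ?_
    rw [restrictDerivation_snd, hu, hδ]

variable (V F φ) in
/-- The isomorphism between the fibres of the pull-back Lie algebroid and the derivations of the
pull-back bundle. -/
def pullbackEquivDerivation (m : M) :
    AlgebroidData.PullbackFibre (derivationAlgebroid J V F) φ m ≃ₗ[ℝ]
      DerivationFibre I V (φ *ᵖ F) m :=
  (LinearEquiv.ofBijective _ (bijective_derivationToPullback m)).symm

end PullbackDerivations

/-! ### Frames of the bundle of derivations -/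

section DerivationFrame

variable {E : Type*} [NormedAddCommGroup E] [NormedSpace ℝ E] {H : Type*}
  [TopologicalSpace H] {I : ModelWithCorners ℝ E H} {M : Type*} [TopologicalSpace M]
  [ChartedSpace H M]
  {V : Type*} [NormedAddCommGroup V] [NormedSpace ℝ V]
  {F : M → Type*} [TopologicalSpace (TotalSpace V F)] [∀ x, AddCommGroup (F x)]
  [∀ x, Module ℝ (F x)] [∀ x, TopologicalSpace (F x)] [FiberBundle V F] [VectorBundle ℝ V F]
  [IsManifold I ∞ M] [FiniteDimensional ℝ E] [T2Space M]

theorem mvfderiv_sum_apply {l : ℕ} {g : Fin l → M → ℝ} {x : M}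
    (hg : ∀ j, MDifferentiableAt I 𝓘(ℝ, ℝ) (g j) x) (v : TangentSpace I x) :
    mvfderiv I (∑ j, g j) x v = ∑ j, mvfderiv I (g j) x v := by
  have h : ∀ s : Finset (Fin l), MDifferentiableAt I 𝓘(ℝ, ℝ) (∑ j ∈ s, g j) x ∧
      mvfderiv I (∑ j ∈ s, g j) x v = ∑ j ∈ s, mvfderiv I (g j) x v := by
    classical
    intro s
    induction s using Finset.induction_on with
    | empty =>
      refine ⟨mdifferentiableAt_const, ?_⟩
      rw [Finset.sum_empty, Finset.sum_empty, mvfderiv_zero]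
      rfl
    | insert j s hj ih =>
      rw [Finset.sum_insert hj, Finset.sum_insert hj]
      refine ⟨(hg j).add ih.1, ?_⟩
      rw [mvfderiv_add (hg j) ih.1, add_apply, ih.2]
  exact (h Finset.univ).2

/-- Every germ of a smooth family of derivations is the germ of a global one. -/
theorem exists_derivationSection_eventuallyEq {W : Set M} (hW : IsOpen W) {x : M} (hx : x ∈ W)
    {d₀ : ∀ x, DerivationFibre I V F x} (hd : DerivationSmoothOn W d₀) :
    ∃ d : ∀ x, DerivationFibre I V F x, DerivationSmoothOn Set.univ d ∧
      ∀ᶠ y in 𝓝 x, d y = d₀ y := by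
  obtain ⟨f, h1, hf⟩ := exists_smooth_eventuallyEq_one (I := I) hW hx
  refine ⟨fun y => f y • d₀ y, ⟨fun s => ?_, ?_⟩, ?_⟩
  · exact (ContMDiffOn.smul_section_of_tsupport f.contMDiff.contMDiffOn hW hf (hd.1 s)).contMDiffOn
  · exact (ContMDiffOn.smul_section_of_tsupport f.contMDiff.contMDiffOn hW hf hd.2).contMDiffOn
  · filter_upwards [h1] with y hy
    rw [hy, one_smul]

/-- Smooth global families of derivations which, near `x₀`, are the frame of the bundle of
derivations dual to the coordinates `derivationCoords`. -/
theorem exists_derivationFrame [FiniteDimensional ℝ V] [ContMDiffVectorBundle ∞ V F I] {x₀ : M}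
    (fr : LocalFrame I V F x₀) :
    ∃ b : DerivationIndex E V → ∀ x, DerivationFibre I V F x,
      (∀ k, DerivationSmoothOn Set.univ (b k)) ∧
      ∀ᶠ y in 𝓝 x₀, ∀ d : DerivationFibre I V F y,
        d = ∑ k, derivationCoords fr y d k • b k y := by
  classical
  choose d₀ hd₀ using fun (k : DerivationIndex E V) (y : M) (hy : y ∈ derivationDom fr) =>
    (bijective_derivationCoords fr hy).2 (Pi.single k 1)
  let d₁ : DerivationIndex E V → ∀ x, DerivationFibre I V F x := fun k y =>
    if hy : y ∈ derivationDom fr then d₀ k y hy else 0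
  have hd₁ : ∀ k, ∀ y ∈ derivationDom fr, derivationCoords fr y (d₁ k y) = Pi.single k 1 := by
    intro k y hy
    simp only [d₁, hy, dif_pos, hd₀]
  have hs : ∀ k, DerivationSmoothOn (derivationDom fr) (d₁ k) := fun k =>
    (derivationSmoothOn_iff_coords fr (isOpen_derivationDom fr) subset_rfl _).2 fun i =>
      contMDiffOn_const.congr fun y hy => congrFun (hd₁ k y hy) i
  choose b hb hbd using fun k =>
    exists_derivationSection_eventuallyEq (isOpen_derivationDom fr) (mem_derivationDom fr) (hs k)
  refine ⟨b, hb, ?_⟩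
  filter_upwards [Filter.eventually_all.2 hbd,
    (isOpen_derivationDom fr).mem_nhds (mem_derivationDom fr)] with y hy hyd d
  refine (bijective_derivationCoords fr hyd).1 (funext fun i => ?_)
  simp [-Fintype.sum_sum_type, map_sum, hy, hd₁ _ y hyd, Pi.single_apply]

/-- Tangent vectors are separated by smooth functions, namely by extensions of the germs of the
coordinate functions of a chart. -/
theorem tangent_ext {x : M} {v v' : TangentSpace I x}
    (h : ∀ f : C^∞⟮I, M; ℝ⟯, mvfderiv I f x v = mvfderiv I f x v') : v = v' := by
  have hinj : Function.Injective (mfderiv I 𝓘(ℝ, E) (extChartAt I x) x) :=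
    (isInvertible_mfderiv_extChartAt (mem_extChartAt_source (I := I) x)).injective
  refine hinj ((Module.finBasis ℝ E).equivFun.injective (funext fun i => ?_))
  let ℓ : E →L[ℝ] ℝ := LinearMap.toContinuousLinearMap ((Module.finBasis ℝ E).coord i)
  have hs : ContMDiffOn I 𝓘(ℝ, ℝ) ∞ (ℓ ∘ extChartAt I x) (extChartAt I x).source := by
    rw [extChartAt_source]
    exact ℓ.contMDiff.comp_contMDiffOn contMDiffOn_extChartAt
  obtain ⟨f, hf⟩ := exists_contMDiffMap_eventuallyEq (isOpen_extChartAt_source x)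
    (mem_extChartAt_source (I := I) x) hs
  have e : ∀ w : TangentSpace I x,
      mvfderiv I f x w = ℓ (mfderiv I 𝓘(ℝ, E) (extChartAt I x) x w) := by
    intro w
    rw [mvfderiv_eq_of_eventuallyEq hf]
    have h1 : MDifferentiableAt I 𝓘(ℝ, E) (extChartAt I x) x :=
      mdifferentiableAt_extChartAt (mem_chart_source H x)
    refine (mvfderiv_comp_apply x (ℓ.contMDiff.mdifferentiableAt one_ne_zero) h1 w).trans ?_
    change mfderiv 𝓘(ℝ, E) 𝓘(ℝ, ℝ) ℓ (extChartAt I x x) _ = _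
    rw [ContinuousLinearMap.mfderiv_eq]
    rfl
  have := h f
  rw [e, e] at this
  exact this

end DerivationFrame

/-! ### Smooth sections of the fibre product -/

section PullbackSmooth

variable {E : Type*} [NormedAddCommGroup E] [NormedSpace ℝ E] {H : Type*}
  [TopologicalSpace H] {I : ModelWithCorners ℝ E H} {M : Type*} [TopologicalSpace M]
  [ChartedSpace H M] [IsManifold I ∞ M]
  {E' : Type*} [NormedAddCommGroup E'] [NormedSpace ℝ E'] {H' : Type*}
  [TopologicalSpace H'] {J : ModelWithCorners ℝ E' H'} {N : Type*} [TopologicalSpace N]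
  [ChartedSpace H' N] [IsManifold J ∞ N]
  {V : Type*} [NormedAddCommGroup V] [NormedSpace ℝ V] [FiniteDimensional ℝ V]
  {F : N → Type*} [TopologicalSpace (TotalSpace V F)] [∀ x, AddCommGroup (F x)]
  [∀ x, Module ℝ (F x)] [∀ x, TopologicalSpace (F x)] [FiberBundle V F] [VectorBundle ℝ V F]
  [ContMDiffVectorBundle ∞ V F J]
  {φ : C^∞⟮I, M; J, N⟯}
  [FiniteDimensional ℝ E] [FiniteDimensional ℝ E'] [T2Space M] [T2Space N]

/-- The derivations of `F` along `φ` which come from a smooth section `d` of the derivations of the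
pull-back bundle have smooth coordinates. -/
theorem contMDiffOn_coords_restrictDerivation {m : M} (fr : LocalFrame J V F (φ m)) {W : Set M}
    (hW : ∀ x ∈ W, φ x ∈ derivationDom fr) {d : ∀ x, DerivationFibre I V (φ *ᵖ F) x}
    (hd : DerivationSmoothOn W d) (k : DerivationIndex E' V) :
    ContMDiffOn I 𝓘(ℝ, ℝ) ∞
      (fun x => derivationCoords fr (φ x) (restrictDerivation φ x (d x)) k) W := by
  rcases k with ⟨i, j⟩ | k
  · exact (contMDiffOn_section_iff_frameCoeff (I := I) (F := φ *ᵖ F) (x₀ := m)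
      (fun x hx => fr.dom_subset (hW x hx).1) _).1 (hd.1 (pullbackSection φ (fr.sec j))) i
  · have h1 : ContMDiff I.tangent J.tangent ∞ (tangentMap I J φ) :=
      φ.contMDiff.contMDiff_tangentMap (by simp)
    exact contMDiffOn_frameCoeff_of_map (F := (TangentSpace J : N → Type _))
      (h1.comp_contMDiffOn hd.2) (fun x hx => (hW x hx).2) k

variable [CompleteSpace E']

/-- The restrictions of a smooth family of derivations of the pull-back bundle are locally of the
form `∑ f_i ⊗ b_i`, where the `b_i` are a frame of the bundle of derivations of `F`. -/
theorem exists_representsNear {U : Set M} (hU : IsOpen U) {m : M} (hm : m ∈ U)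
    {d : ∀ x, DerivationFibre I V (φ *ᵖ F) x} (hd : DerivationSmoothOn U d) :
    ∃ (k : ℕ) (f : Fin k → C^∞⟮I, M; ℝ⟯) (b : Fin k → ∀ y, DerivationFibre J V F y),
      AlgebroidData.RepresentsNear (derivationAlgebroid J V F) φ
        (fun x => restrictDerivation φ x (d x)) m f b := by
  obtain ⟨fr⟩ := nonempty_localFrame J V F (φ m)
  obtain ⟨b, hb, hbd⟩ := exists_derivationFrame fr
  let W := U ∩ φ ⁻¹' derivationDom fr
  have hW : IsOpen W := hU.inter ((isOpen_derivationDom fr).preimage φ.contMDiff.continuous)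
  have hmW : m ∈ W := ⟨hm, mem_derivationDom fr⟩
  have hdW : DerivationSmoothOn W d :=
    ⟨fun s => (hd.1 s).mono Set.inter_subset_left, hd.2.mono Set.inter_subset_left⟩
  choose f hf using fun k => exists_contMDiffMap_eventuallyEq hW hmW
    (contMDiffOn_coords_restrictDerivation fr (fun x hx => hx.2) hdW k)
  let e := Fintype.equivFin (DerivationIndex E' V)
  refine ⟨_, fun i => f (e.symm i), fun i => b (e.symm i), fun i => hb _, ?_⟩
  filter_upwards [φ.contMDiff.continuous.continuousAt.eventually hbd,
    Filter.eventually_all.2 hf] with x hx hfx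
  refine (hx (restrictDerivation φ x (d x))).trans ?_
  simp only [← hfx]
  exact (e.symm.sum_comp (fun k => f k x • b k (φ x))).symm

theorem restrictDerivation_apply_of_represents {k : ℕ} {f : Fin k → C^∞⟮I, M; ℝ⟯}
    {b : Fin k → ∀ y, DerivationFibre J V F y} {x : M} {d : DerivationFibre I V (φ *ᵖ F) x}
    (h : restrictDerivation φ x d = ∑ i, f i x • b i (φ x)) (s : Cₛ^∞⟮J; V, F⟯) :
    d.1.1 (pullbackSection φ s) = ∑ i, f i x • (b i (φ x)).1.1 s := by
  rw [← restrictDerivation_fst, h]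
  simp [Prod.fst_sum, LinearMap.sum_apply]
  rfl

theorem mfderiv_symbol_of_represents {k : ℕ} {f : Fin k → C^∞⟮I, M; ℝ⟯}
    {b : Fin k → ∀ y, DerivationFibre J V F y} {x : M} {d : DerivationFibre I V (φ *ᵖ F) x}
    (h : restrictDerivation φ x d = ∑ i, f i x • b i (φ x)) :
    mfderiv I J φ x d.1.2 = ∑ i, f i x • (b i (φ x)).1.2 := by
  rw [← restrictDerivation_snd, h]
  simp [Prod.snd_sum]

/-- Conversely, a family of derivations whose restrictions are locally of the form `∑ f_i ⊗ b_i`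
sends the sections of a pulled-back frame to smooth sections. -/
theorem derivationSmoothOn_of_represents {U : Set M} (hU : IsOpen U)
    {d : ∀ x, DerivationFibre I V (φ *ᵖ F) x} (hu : SmoothFieldOn (fun x => (d x).1.2) U)
    (hr : ∀ m ∈ U, ∃ (k : ℕ) (f : Fin k → C^∞⟮I, M; ℝ⟯)
      (b : Fin k → ∀ y, DerivationFibre J V F y),
      AlgebroidData.RepresentsNear (derivationAlgebroid J V F) φ
        (fun x => restrictDerivation φ x (d x)) m f b) : DerivationSmoothOn U d := by
  have : CompleteSpace E := FiniteDimensional.complete ℝ E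
  refine (derivationAlgebroid_isLocal (I := I) (F := φ *ᵖ F)).glue U hU d fun m hm => ?_
  obtain ⟨k, f, b, hb, hfb⟩ := hr m hm
  obtain ⟨fr⟩ := nonempty_localFrame J V F (φ m)
  obtain ⟨W, hW, hWo, hmW⟩ := eventually_nhds_iff.1 hfb
  refine ⟨U ∩ W ∩ fr.pullback.dom, (hU.inter hWo).inter fr.pullback.isOpen_dom,
    ⟨⟨hm, hmW⟩, fr.pullback.mem_dom⟩, ?_⟩
  refine derivationSmoothOn_of_frame fr.pullback ((hU.inter hWo).inter fr.pullback.isOpen_dom)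
    Set.inter_subset_right (fun j => ?_) (hu.mono fun x hx => hx.1.1)
  have hs : ContMDiff I (I.prod 𝓘(ℝ, V)) ∞ (fun x => (⟨x,
      (∑ i, smulSection I V (φ *ᵖ F) (f i)
        (pullbackSection φ (derivationOperator (b i) (hb i) (fr.sec j)))) x⟩ :
        TotalSpace V (φ *ᵖ F))) := ContMDiffSection.contMDiff _
  refine hs.contMDiffOn.congr fun x hx => ?_
  rw [sum_smulSection_apply]
  exact congrArg _ (restrictDerivation_apply_of_represents (hW x hx.1.2) (fr.sec j))

/-- A family of derivations of the pull-back bundle is smooth if and only if the corresponding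
section of the fibre product is. -/
theorem derivationSmoothOn_iff_pullbackSmoothOn {U : Set M} (hU : IsOpen U)
    (d : ∀ x, DerivationFibre I V (φ *ᵖ F) x) :
    DerivationSmoothOn U d ↔ AlgebroidData.PullbackSmoothOn (derivationAlgebroid J V F) φ U
      (fun x => derivationToPullback φ x (d x)) :=
  ⟨fun hd => ⟨fun _ hm => exists_representsNear hU hm hd, hd.2⟩,
    fun h => derivationSmoothOn_of_represents hU h.2 h.1⟩

/-! ### The bracket formula -/

/-- The composition of two derivations of the pull-back bundle on a pulled-back section, in terms
of local representations. -/
theorem comp_derivation_of_represents {k l : ℕ} {f : Fin k → C^∞⟮I, M; ℝ⟯}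
    {b : Fin k → ∀ y, DerivationFibre J V F y} {g : Fin l → C^∞⟮I, M; ℝ⟯}
    {c : Fin l → ∀ y, DerivationFibre J V F y} {m : M}
    {d₁ : DerivationFibre I V (φ *ᵖ F) m} {d₂ : ∀ x, DerivationFibre I V (φ *ᵖ F) x}
    (h₂ : DerivationSmoothOn Set.univ d₂) (hc : ∀ j, DerivationSmoothOn Set.univ (c j))
    (hfb : restrictDerivation φ m d₁ = ∑ i, f i m • b i (φ m))
    (hgc : ∀ᶠ x in 𝓝 m, restrictDerivation φ x (d₂ x) = ∑ j, g j x • c j (φ x))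
    (s : Cₛ^∞⟮J; V, F⟯) :
    d₁.1.1 (derivationOperator d₂ h₂ (pullbackSection φ s)) =
      ∑ i, ∑ j, (f i m * g j m) • (b i (φ m)).1.1 (derivationOperator (c j) (hc j) s) +
      ∑ j, mvfderiv I (g j) m d₁.1.2 • (c j (φ m)).1.1 s := by
  have e : ∀ᶠ x in 𝓝 m, derivationOperator d₂ h₂ (pullbackSection φ s) x =
      (∑ j, smulSection I V (φ *ᵖ F) (g j)
        (pullbackSection φ (derivationOperator (c j) (hc j) s))) x := by
    filter_upwards [hgc] with x hx
    rw [sum_smulSection_apply]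
    exact restrictDerivation_apply_of_represents hx s
  rw [derivation_congr d₁ e, derivation_sum_smulSection, Finset.sum_add_distrib,
    Finset.sum_comm]
  refine congrArg₂ _ (Finset.sum_congr rfl fun j _ => ?_) rfl
  rw [restrictDerivation_apply_of_represents hfb]
  refine (Finset.smul_sum (r := g j m)
    (f := fun i => f i m • (b i (φ m)).1.1 (derivationOperator (c j) (hc j) s))).trans ?_
  refine Finset.sum_congr rfl fun i _ => ?_
  rw [smul_smul, mul_comm]

/-- The analogue of `comp_derivation_of_represents` for the symbols and pulled-back functions. -/
theorem comp_symbol_of_represents {k l : ℕ} {f : Fin k → C^∞⟮I, M; ℝ⟯}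
    {b : Fin k → ∀ y, DerivationFibre J V F y} {g : Fin l → C^∞⟮I, M; ℝ⟯}
    {c : Fin l → ∀ y, DerivationFibre J V F y} {m : M}
    {d₁ : DerivationFibre I V (φ *ᵖ F) m} {d₂ : ∀ x, DerivationFibre I V (φ *ᵖ F) x}
    (hc : ∀ j, DerivationSmoothOn Set.univ (c j))
    (hfb : restrictDerivation φ m d₁ = ∑ i, f i m • b i (φ m))
    (hgc : ∀ᶠ x in 𝓝 m, restrictDerivation φ x (d₂ x) = ∑ j, g j x • c j (φ x))
    (h : C^∞⟮J, N; ℝ⟯) :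
    mvfderiv I (fun x => mvfderiv I (h.comp φ) x (d₂ x).1.2) m d₁.1.2 =
      ∑ i, ∑ j, (f i m * g j m) *
        mvfderiv J (fun y => mvfderiv J h y (c j y).1.2) (φ m) (b i (φ m)).1.2 +
      ∑ j, mvfderiv I (g j) m d₁.1.2 * mvfderiv J h (φ m) (c j (φ m)).1.2 := by
  let ch : Fin l → C^∞⟮J, N; ℝ⟯ := fun j => fieldApply _ (hc j).2 h
  have e : (fun x => mvfderiv I (h.comp φ) x (d₂ x).1.2) =ᶠ[𝓝 m]
      ∑ j, ⇑(g j) * ⇑((ch j).comp φ) := by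
    filter_upwards [hgc] with x hx
    rw [mvfderiv_comp_map, mfderiv_symbol_of_represents hx, map_sum, Finset.sum_apply]
    refine Finset.sum_congr rfl fun j _ => ?_
    rw [map_smul]
    rfl
  have hsum : mvfderiv I (∑ j, ⇑(g j) * ⇑((ch j).comp φ)) m d₁.1.2 =
      ∑ j, mvfderiv I (⇑(g j) * ⇑((ch j).comp φ)) m d₁.1.2 :=
    mvfderiv_sum_apply (fun j => ((g j).contMDiff.mul
      ((ch j).comp φ).contMDiff).mdifferentiableAt (by simp)) _
  rw [mvfderiv_eq_of_eventuallyEq e, hsum, Finset.sum_comm, ← Finset.sum_add_distrib]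
  refine Finset.sum_congr rfl fun j _ => ?_
  rw [mvfderiv_mul ((g j).contMDiff.mdifferentiableAt (by simp))
    (((ch j).comp φ).contMDiff.mdifferentiableAt (by simp))]
  simp only [add_apply, smul_apply, smul_eq_mul]
  rw [mvfderiv_comp_map, mfderiv_symbol_of_represents hfb, map_sum, Finset.mul_sum]
  refine congrArg₂ _ (Finset.sum_congr rfl fun i _ => ?_) (mul_comm _ _)
  rw [map_smul, smul_eq_mul, ← mul_assoc, mul_comm (g j m)]
  rfl

variable [CompleteSpace E]

/-- The bracket of sections of the pull-back Lie algebroid is the commutator of the corresponding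
derivations: the two are compared on sections and functions pulled back from `N`. -/
theorem isPullbackBracketAt_commutator {d₁ d₂ : ∀ x, DerivationFibre I V (φ *ᵖ F) x}
    (h₁ : DerivationSmoothOn Set.univ d₁) (h₂ : DerivationSmoothOn Set.univ d₂) (m : M) :
    AlgebroidData.IsPullbackBracketAt (derivationAlgebroid J V F) φ
      (fun x => derivationToPullback φ x (d₁ x)) (fun x => derivationToPullback φ x (d₂ x)) m
      (derivationToPullback φ m (derivationCommutator d₁ d₂ h₁ h₂ m)) := by
  refine ⟨fun k l f (b : Fin k → ∀ y, DerivationFibre J V F y) g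
    (c : Fin l → ∀ y, DerivationFibre J V F y) hfb hgc => ?_, rfl⟩
  obtain ⟨hb, hfb⟩ := hfb
  obtain ⟨hc, hgc⟩ := hgc
  replace hb : ∀ i, DerivationSmoothOn Set.univ (b i) := hb
  replace hc : ∀ i, DerivationSmoothOn Set.univ (c i) := hc
  replace hfb : ∀ᶠ x in 𝓝 m, restrictDerivation φ x (d₁ x) = ∑ i, f i x • b i (φ x) := hfb
  replace hgc : ∀ᶠ x in 𝓝 m, restrictDerivation φ x (d₂ x) = ∑ j, g j x • c j (φ x) := hgc
  have hbr : ∀ i j, (derivationAlgebroid J V F).bracket (b i) (c j) (φ m) =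
      derivationCommutator (b i) (c j) (hb i) (hc j) (φ m) := fun i j =>
    congrFun (derivationAlgebroid_bracket (hb i) (hc j)) (φ m)
  simp only [hbr]
  change restrictDerivation φ m (derivationCommutator d₁ d₂ h₁ h₂ m) =
    (∑ i, ∑ j, (f i m * g j m) • derivationCommutator (b i) (c j) (hb i) (hc j) (φ m) +
      ∑ j, mvfderiv I (g j) m (d₁ m).1.2 • c j (φ m) -
      ∑ i, mvfderiv I (f i) m (d₂ m).1.2 • b i (φ m) : DerivationFibre J V F (φ m))
  refine Subtype.ext (Prod.ext (LinearMap.ext fun s => ?_) ?_)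
  · rw [restrictDerivation_fst, derivationCommutator_fst,
      comp_derivation_of_represents h₂ hc hfb.self_of_nhds hgc,
      comp_derivation_of_represents h₁ hb hgc.self_of_nhds hfb]
    simp only [Submodule.coe_sub, Submodule.coe_add, Submodule.coe_sum, Submodule.coe_smul,
      Prod.fst_sub, Prod.fst_add, Prod.fst_sum, Prod.smul_fst, LinearMap.sub_apply,
      LinearMap.add_apply, LinearMap.sum_apply, LinearMap.smul_apply, derivationCommutator_fst,
      smul_sub, Finset.sum_sub_distrib]
    rw [Finset.sum_comm (f := fun j i => (g j m * f i m) • _)]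
    simp only [mul_comm (g _ m)]
    abel
  · refine tangent_ext fun h => ?_
    rw [restrictDerivation_snd, derivationCommutator_snd, ← mvfderiv_comp_map,
      mvfderiv_mlieBracket (contMDiffOn_univ.1 h₁.2) (contMDiffOn_univ.1 h₂.2)
        (h.comp φ).contMDiff,
      comp_symbol_of_represents hc hfb.self_of_nhds hgc,
      comp_symbol_of_represents hb hgc.self_of_nhds hfb]
    simp only [Submodule.coe_sub, Submodule.coe_add, Submodule.coe_sum, Submodule.coe_smul,
      Prod.snd_sub, Prod.snd_add, Prod.snd_sum, Prod.smul_snd, map_sub, map_add, map_sum, map_smul,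
      smul_eq_mul, derivationCommutator_snd]
    simp only [mvfderiv_mlieBracket (contMDiffOn_univ.1 (hb _).2) (contMDiffOn_univ.1 (hc _).2)
        h.contMDiff, mul_sub, Finset.sum_sub_distrib]
    rw [Finset.sum_comm (f := fun j i => (g j m * f i m) * _)]
    simp only [mul_comm (g _ m)]
    abel

end PullbackSmooth

/-! ### Transport of Lie algebroid structures -/

namespace AlgebroidData

variable {E : Type*} [NormedAddCommGroup E] [NormedSpace ℝ E] {H : Type*}
  [TopologicalSpace H] {I : ModelWithCorners ℝ E H} {M : Type*} [TopologicalSpace M]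
  [ChartedSpace H M]

theorem IsSmoothVectorBundle.add_section {A : AlgebroidData I M} (hA : A.IsSmoothVectorBundle)
    {s t : ∀ x, A.Fib x} (hs : A.IsSection s) (ht : A.IsSection t) : A.IsSection (s + t) := by
  obtain ⟨r, _, _, _, _, _, h⟩ := hA
  exact (h _ isOpen_univ _).2 (((h _ isOpen_univ _).1 hs).add_section ((h _ isOpen_univ _).1 ht))

theorem IsSmoothVectorBundle.smul_section {A : AlgebroidData I M} (hA : A.IsSmoothVectorBundle)
    {f : M → ℝ} (hf : ContMDiff I 𝓘(ℝ, ℝ) ∞ f) {s : ∀ x, A.Fib x} (hs : A.IsSection s) :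
    A.IsSection (fun x => f x • s x) := by
  obtain ⟨r, _, _, _, _, _, h⟩ := hA
  exact (h _ isOpen_univ _).2 (hf.contMDiffOn.smul_section ((h _ isOpen_univ _).1 hs))

variable {A B : AlgebroidData I M}

theorem Iso.isSection_iff (e : A.Iso B) (s : ∀ x, A.Fib x) :
    A.IsSection s ↔ B.IsSection (fun x => e.equiv x (s x)) :=
  e.smooth_iff Set.univ isOpen_univ s

theorem IsLocal.of_iso (e : A.Iso B) (hB : B.IsLocal) : A.IsLocal where
  mono W W' hW hW' h s hs :=
    (e.smooth_iff W' hW' s).2 (hB.mono W W' hW hW' h _ ((e.smooth_iff W hW s).1 hs))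
  glue W hW s h := (e.smooth_iff W hW s).2 <| hB.glue W hW _ fun x hx => by
    obtain ⟨W', hW', hx', hs⟩ := h x hx
    exact ⟨W', hW', hx', (e.smooth_iff W' hW' s).1 hs⟩

/-- The axioms of a Lie algebroid are transported along an isomorphism. -/
theorem IsLieAlgebroid.of_iso [IsManifold I ∞ M] (e : A.Iso B) (hB : B.IsLieAlgebroid)
    (hA : A.IsSmoothVectorBundle) : A.IsLieAlgebroid := by
  have hi := fun s => (e.isSection_iff s).1
  have hbr : ∀ s t, A.IsSection s → A.IsSection t →
      (fun x => e.equiv x (A.bracket s t x)) =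
        B.bracket (fun y => e.equiv y (s y)) (fun y => e.equiv y (t y)) :=
    fun s t hs ht => funext (e.map_bracket s t hs ht)
  have hsm : ∀ s t, A.IsSection s → A.IsSection t → A.IsSection (A.bracket s t) := by
    intro s t hs ht
    rw [e.isSection_iff, hbr s t hs ht]
    exact hB.bracket_smooth _ _ (hi s hs) (hi t ht)
  have hanchor : ∀ s : ∀ x, A.Fib x,
      (fun x => A.anchor x (s x)) = fun x => B.anchor x (e.equiv x (s x)) :=
    fun s => funext fun x => (e.map_anchor x (s x)).symm
  have hadd : ∀ s t : ∀ x, A.Fib x, (fun y => e.equiv y ((s + t) y)) =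
      (fun y => e.equiv y (s y)) + fun y => e.equiv y (t y) :=
    fun s t => funext fun y => map_add _ _ _
  refine ⟨hA, fun U hU s hs => ?_, hsm, fun r s t hr hs ht => ?_, fun c s t hs ht => ?_,
    fun s t hs ht => ?_, fun r s t hr hs ht => ?_, fun s t f hs ht x => ?_, fun s t hs ht x => ?_⟩
  · rw [hanchor]
    exact hB.anchor_smooth U hU _ ((e.smooth_iff U hU s).1 hs)
  · funext x
    apply (e.equiv x).injective
    rw [e.map_bracket r _ hr (hA.add_section hs ht), hadd,
      hB.bracket_add _ _ _ (hi r hr) (hi s hs) (hi t ht), Pi.add_apply, Pi.add_apply, map_add,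
      e.map_bracket r s hr hs, e.map_bracket r t hr ht]
  · funext x
    have hct : A.IsSection (c • t) := hA.smul_section contMDiff_const ht
    have hc : (fun y => e.equiv y ((c • t) y)) = c • fun y => e.equiv y (t y) :=
      funext fun y => map_smul _ _ _
    apply (e.equiv x).injective
    rw [e.map_bracket s _ hs hct, hc, hB.bracket_smul _ _ _ (hi s hs) (hi t ht), Pi.smul_apply,
      Pi.smul_apply, map_smul, e.map_bracket s t hs ht]
  · funext x
    apply (e.equiv x).injective
    rw [e.map_bracket s t hs ht, hB.bracket_skew _ _ (hi s hs) (hi t ht), Pi.neg_apply,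
      Pi.neg_apply, map_neg, e.map_bracket t s ht hs]
  · funext x
    apply (e.equiv x).injective
    rw [Pi.add_apply, Pi.add_apply, map_add, map_add, e.map_bracket r _ hr (hsm s t hs ht),
      e.map_bracket s _ hs (hsm t r ht hr), e.map_bracket t _ ht (hsm r s hr hs),
      hbr s t hs ht, hbr t r ht hr, hbr r s hr hs]
    have := congrFun (hB.jacobi _ _ _ (hi r hr) (hi s hs) (hi t ht)) x
    rw [Pi.add_apply, Pi.add_apply] at this
    rw [this]
    simp
  · apply (e.equiv x).injective
    have hf : (fun y => e.equiv y (f y • t y)) = fun y => f y • e.equiv y (t y) :=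
      funext fun y => map_smul _ _ _
    rw [e.map_bracket s _ hs (hA.smul_section f.contMDiff ht), hf,
      hB.leibniz _ _ f (hi s hs) (hi t ht), map_add, map_smul, map_smul, e.map_bracket s t hs ht,
      e.map_anchor]
  · rw [← e.map_anchor, e.map_bracket s t hs ht, hB.anchor_bracket _ _ (hi s hs) (hi t ht),
      hanchor s, hanchor t]

end AlgebroidData

/-! ### The pull-back of the Lie algebroid of derivations -/

section PullbackIso

variable {E : Type*} [NormedAddCommGroup E] [NormedSpace ℝ E] {H : Type*}
  [TopologicalSpace H] {I : ModelWithCorners ℝ E H} {M : Type*} [TopologicalSpace M]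
  [ChartedSpace H M] [IsManifold I ∞ M]
  {E' : Type*} [NormedAddCommGroup E'] [NormedSpace ℝ E'] {H' : Type*}
  [TopologicalSpace H'] {J : ModelWithCorners ℝ E' H'} {N : Type*} [TopologicalSpace N]
  [ChartedSpace H' N] [IsManifold J ∞ N]

open AlgebroidData in
/-- The bracket formula determines the bracket, since smooth sections have representations. -/
theorem isPullbackBracketAt_unique {B : AlgebroidData J N} {φ : C^∞⟮I, M; J, N⟯}
    {s t : ∀ m, PullbackFibre B φ m} (hs : PullbackSmoothOn B φ Set.univ s)
    (ht : PullbackSmoothOn B φ Set.univ t) {m : M} {w w' : PullbackFibre B φ m}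
    (h : IsPullbackBracketAt B φ s t m w) (h' : IsPullbackBracketAt B φ s t m w') : w = w' := by
  obtain ⟨k, f, b, hfb⟩ := hs.1 m trivial
  obtain ⟨l, g, c, hgc⟩ := ht.1 m trivial
  exact Subtype.ext (Prod.ext ((h.1 k l f b g c hfb hgc).trans (h'.1 k l f b g c hfb hgc).symm)
    (h.2.trans h'.2.symm))

variable {V : Type*} [NormedAddCommGroup V] [NormedSpace ℝ V] [FiniteDimensional ℝ V]
  {F : N → Type*} [TopologicalSpace (TotalSpace V F)] [∀ x, AddCommGroup (F x)]
  [∀ x, Module ℝ (F x)] [∀ x, TopologicalSpace (F x)] [FiberBundle V F] [VectorBundle ℝ V F]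
  [ContMDiffVectorBundle ∞ V F J]
  {φ : C^∞⟮I, M; J, N⟯}
  [FiniteDimensional ℝ E] [FiniteDimensional ℝ E'] [T2Space M] [T2Space N]
  [CompleteSpace E] [CompleteSpace E']

@[simp]
theorem derivationToPullback_pullbackEquivDerivation (m : M)
    (a : AlgebroidData.PullbackFibre (derivationAlgebroid J V F) φ m) :
    derivationToPullback φ m (pullbackEquivDerivation V F φ m a) = a :=
  (LinearEquiv.ofBijective _
    (bijective_derivationToPullback (V := V) (F := F) (φ := φ) m)).apply_symm_apply a

@[simp]
theorem pullbackEquivDerivation_derivationToPullback (m : M)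
    (d : DerivationFibre I V (φ *ᵖ F) m) :
    pullbackEquivDerivation V F φ m (derivationToPullback φ m d) = d :=
  (LinearEquiv.ofBijective _
    (bijective_derivationToPullback (V := V) (F := F) (φ := φ) m)).symm_apply_apply d

theorem derivationToPullback_equiv
    (s : ∀ m, AlgebroidData.PullbackFibre (derivationAlgebroid J V F) φ m) :
    (fun m => derivationToPullback φ m (pullbackEquivDerivation V F φ m (s m))) = s :=
  funext fun m => derivationToPullback_pullbackEquivDerivation m (s m)

theorem pullbackSmoothOn_iff_derivationSmoothOn {U : Set M} (hU : IsOpen U)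
    (s : ∀ m, AlgebroidData.PullbackFibre (derivationAlgebroid J V F) φ m) :
    AlgebroidData.PullbackSmoothOn (derivationAlgebroid J V F) φ U s ↔
      DerivationSmoothOn U (fun m => pullbackEquivDerivation V F φ m (s m)) := by
  rw [derivationSmoothOn_iff_pullbackSmoothOn hU, derivationToPullback_equiv s]

theorem isPullbackBracketAt_of_smooth
    {s t : ∀ m, AlgebroidData.PullbackFibre (derivationAlgebroid J V F) φ m}
    (hs : DerivationSmoothOn Set.univ (fun m => pullbackEquivDerivation V F φ m (s m)))
    (ht : DerivationSmoothOn Set.univ (fun m => pullbackEquivDerivation V F φ m (t m))) (m : M) :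
    AlgebroidData.IsPullbackBracketAt (derivationAlgebroid J V F) φ s t m
      (derivationToPullback φ m (derivationCommutator _ _ hs ht m)) := by
  have h := isPullbackBracketAt_commutator hs ht m
  rwa [derivationToPullback_equiv s, derivationToPullback_equiv t] at h

variable (J V F φ)

theorem pullbackBracketWellDefined_derivationAlgebroid :
    (derivationAlgebroid J V F).PullbackBracketWellDefined φ := by
  intro s t hs ht m
  have hs' := (pullbackSmoothOn_iff_derivationSmoothOn isOpen_univ s).1 hs
  have ht' := (pullbackSmoothOn_iff_derivationSmoothOn isOpen_univ t).1 ht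
  exact ⟨_, isPullbackBracketAt_of_smooth hs' ht' m, fun w hw =>
    isPullbackBracketAt_unique hs ht hw (isPullbackBracketAt_of_smooth hs' ht' m)⟩

/-- The pull-back of the Lie algebroid of derivations is isomorphic to the Lie algebroid of
derivations of the pull-back. -/
def pullbackDerivationIso :
    ((derivationAlgebroid J V F).pullback φ).Iso (derivationAlgebroid I V (φ *ᵖ F)) where
  equiv m := pullbackEquivDerivation V F φ m
  smooth_iff U hU s := pullbackSmoothOn_iff_derivationSmoothOn hU s
  map_anchor m a := congrArg (fun p => p.1.2)
    (derivationToPullback_pullbackEquivDerivation m a)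
  map_bracket s t hs ht m := by
    have hs' := (pullbackSmoothOn_iff_derivationSmoothOn isOpen_univ s).1 hs
    have ht' := (pullbackSmoothOn_iff_derivationSmoothOn isOpen_univ t).1 ht
    have h := isPullbackBracketAt_of_smooth hs' ht' m
    -- the bracket of the pull-back is a chosen solution of the bracket formula; one exists by `h`
    have e : ((derivationAlgebroid J V F).pullback φ).bracket s t m =
        derivationToPullback φ m (derivationCommutator _ _ hs' ht' m) :=
      isPullbackBracketAt_unique hs ht (Classical.epsilon_spec ⟨_, h⟩) h
    rw [e]
    refine (pullbackEquivDerivation_derivationToPullback m _).trans ?_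
    exact (congrFun (derivationAlgebroid_bracket hs' ht') m).symm

/-- The coordinates of the bundle of derivations of the pull-back, transported along the fibrewise
isomorphism, are coordinates on the fibre product. -/
theorem pullback_isSmoothVectorBundle :
    ((derivationAlgebroid J V F).pullback φ).IsSmoothVectorBundle := by
  let fr : ∀ x₀ : M, LocalFrame I V (φ *ᵖ F) x₀ := fun x₀ => (nonempty_localFrame _ _ _ x₀).some
  let e := pullbackDerivationIso (I := I) J V F φ
  exact AlgebroidData.isSmoothVectorBundle_of_coordinates _
    (AlgebroidData.IsLocal.of_iso e derivationAlgebroid_isLocal)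
    (fun x₀ => derivationDom (fr x₀)) (fun x₀ => isOpen_derivationDom _)
    (fun x₀ => mem_derivationDom _)
    (fun x₀ x => derivationCoords (fr x₀) x ∘ₗ (e.equiv x).toLinearMap)
    (fun x₀ x hx => (bijective_derivationCoords (fr x₀) hx).comp (e.equiv x).bijective)
    (fun x₀ W hW hWU s => (e.smooth_iff W hW s).trans
      (derivationSmoothOn_iff_coords (fr x₀) hW hWU fun x => e.equiv x (s x)))

/-- The rank of the fibre product is that of the bundle of derivations of the pull-back. -/
theorem admissible_derivationAlgebroid : (derivationAlgebroid J V F).Admissible φ := by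
  refine ⟨Fintype.card (DerivationIndex E V), fun m => ?_⟩
  obtain ⟨fr⟩ := nonempty_localFrame I V (φ *ᵖ F) m
  let L := (pullbackEquivDerivation V F φ m).trans
    (LinearEquiv.ofBijective _ (bijective_derivationCoords fr (mem_derivationDom fr)))
  exact ⟨Module.Finite.equiv L.symm, by rw [L.finrank_eq, Module.finrank_fintype_fun_eq_card]⟩

end PullbackIso

end

theorem proposition3p4
    {E : Type*} [NormedAddCommGroup E] [NormedSpace ℝ E] [FiniteDimensional ℝ E]
    {H : Type*} [TopologicalSpace H] {I : ModelWithCorners ℝ E H} [I.Boundaryless]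
    {M : Type*} [TopologicalSpace M] [ChartedSpace H M] [IsManifold I ∞ M]
    [T2Space M]
    {E' : Type*} [NormedAddCommGroup E'] [NormedSpace ℝ E'] [FiniteDimensional ℝ E']
    {H' : Type*} [TopologicalSpace H'] {J : ModelWithCorners ℝ E' H'} [J.Boundaryless]
    {N : Type*} [TopologicalSpace N] [ChartedSpace H' N] [IsManifold J ∞ N]
    [T2Space N]
    (V : Type*) [NormedAddCommGroup V] [NormedSpace ℝ V] [FiniteDimensional ℝ V]
    (F : N → Type*) [TopologicalSpace (TotalSpace V F)] [∀ y, AddCommGroup (F y)]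
    [∀ y, Module ℝ (F y)] [∀ y, TopologicalSpace (F y)] [FiberBundle V F] [VectorBundle ℝ V F]
    [ContMDiffVectorBundle ∞ V F J]
    (φ : C^∞⟮I, M; J, N⟯) :
    haveI : CompleteSpace E := FiniteDimensional.complete ℝ E
    haveI : CompleteSpace E' := FiniteDimensional.complete ℝ E'
    (derivationAlgebroid J V F).IsLieAlgebroid ∧
    (derivationAlgebroid J V F).Admissible φ ∧
    (derivationAlgebroid J V F).PullbackBracketWellDefined φ ∧
    ((derivationAlgebroid J V F).pullback φ).IsLieAlgebroid ∧
    (derivationAlgebroid I V (φ *ᵖ F)).IsLieAlgebroid ∧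
    Nonempty (((derivationAlgebroid J V F).pullback φ).Iso
      (derivationAlgebroid I V (φ *ᵖ F))) := by
  have : CompleteSpace E := FiniteDimensional.complete ℝ E
  have : CompleteSpace E' := FiniteDimensional.complete ℝ E'
  exact ⟨derivationAlgebroid_isLieAlgebroid, admissible_derivationAlgebroid J V F φ,
    pullbackBracketWellDefined_derivationAlgebroid J V F φ,
    AlgebroidData.IsLieAlgebroid.of_iso (pullbackDerivationIso J V F φ)
      derivationAlgebroid_isLieAlgebroid (pullback_isSmoothVectorBundle J V F φ),
    derivationAlgebroid_isLieAlgebroid, ⟨pullbackDerivationIso J V F φ⟩⟩
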